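/- A \emph{metric measure space} $(X,r,\rho,\mu)$ is a complete separable metric space $(X,r)$ with a point $\rho\in X$ (the root) and a Borel measure $\mu$ on $X$. It is \emph{boundedly finite} if $\mu$ is finite on bounded sets. Two such spaces are identified if there is an isometry $\phi$ from $\operatorname{supp}(\mu)\cup\{\rho\}$ onto $\operatorname{supp}(\mu')\cup\{\rho'\}$ with $\phi(\rho)=\rho'$ and $\phi_*\mu=\mu'$. Let $\mathbb X$ be the set of equivalence classes of boundedly finite spaces, $\mathbb X_{\mathrm{fin}}\subseteq\mathbb X$ the set of those with $\mu(X)<\infty$, and $\mathbb X_{\mathrm{HB}}\subseteq\mathbb X$ the set of those classes that contain a space in which all closed bounded sets are compact. Write $B(x,R)$ and $\overline B(x,R)$ for open and closed balls, and for $\mathcal X=(X,r,\rho,\mu)\in\mathbb X$ and $R>0$ let $\mathcal X|_R:=(X,r,\rho,\mu|_{\overline B(\rho,R)})\in\mathbb X_{\mathrm{fin}}$; for $\mathbb K\subseteq\mathbb X$ let $\mathbb K|_R:=\{\mathcal X|_R:\mathcal X\in\mathbb K\}$. The \emph{Gromov-weak topology} on $\mathbb X_{\mathrm{fin}}$ is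 the one induced by the maps $\mathcal X\mapsto\nu_m^{\mathcal X}$, $m\in\mathbb N$, where $\nu_m^{\mathcal X}$ is the image of $\mu^{\otimes m}$ under $(x_1,\dots,x_m)\mapsto(r(x_i,x_j))_{0\le i<j\le m}$, $x_0:=\rho$, and finite measures on $\mathbb R_+^{\binom{m+1}{2}}$ carry the topology of weak convergence. A sequence $(\mathcal X_n)$ in $\mathbb X$ converges \emph{Gromov-vaguely} to $\mathcal X\in\mathbb X$ if $\mathcal X_n|_R\to\mathcal X|_R$ Gromov-weakly for all but countably many $R>0$; the \emph{Gromov-vague topology} on $\mathbb X$ is the topology in which a set $U$ is open iff every sequence that converges Gromov-vaguely to a point of $U$ is eventually in $U$. A set $\mathbb K\subseteq\mathbb X$ has the \emph{local lower mass-bound property} if for all $R>\delta>0$ $$\inf_{(X,r,\rho,\mu)\in\mathbb K}\ \inf\bigl\{\mu(\overline B(x,\delta)):x\in B(\rho,R)\cap\operatorname{supp}(\mu)\bigr\}>0\qquad(\inf\emptyset:=\infty).$$ A subset of a topological space is \emph{relatively compact} if its closure is compact. \textbf{Corollary (Gromov-vague compactness).} For a set $\mathbb K\subseteq\mathbb X$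 the following are equivalent: (1) $\mathbb K$ is relatively compact in $\mathbb X$ equipped with the Gromov-vague topology. (2) For all $R>0$, $\mathbb K|_R$ is relatively compact in $\mathbb X_{\mathrm{fin}}$ equipped with the Gromov-weak topology. (3) There is a sequence $(R_k)_{k\in\mathbb N}$ of positive reals with $R_k\to\infty$ such that $\mathbb K|_{R_k}$ is relatively compact in $\mathbb X_{\mathrm{fin}}$ equipped with the Gromov-weak topology for every $k$. Furthermore, a set $\mathbb K\subseteq\mathbb X_{\mathrm{HB}}$ that has the local lower mass-bound property is relatively compact in $\mathbb X_{\mathrm{HB}}$ equipped with the (subspace) Gromov-vague topology if and only if, for all $R>0$, $$\sup_{(X,r,\rho,\mu)\in\mathbb K}\mu\bigl(B(\rho,R)\bigr)<\infty .$$ -/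

import Mathlib

open MeasureTheory Filter Topology Set
open scoped ENNReal NNReal

noncomputable section

namespace GromovVague

/-- A pointed, complete, separable metric measure space `(X, r, ρ, μ)` with a Borel measure `μ`
that is finite on all bounded sets (a metric boundedly finite measure space). Every separable
metric space has at most continuum many points, so spaces living in `Type` represent all of them. -/
structure MMSpace where
  carrier : Type
  [metric : MetricSpace carrier]
  [complete : CompleteSpace carrier]
  [separable : TopologicalSpace.SeparableSpace carrier]
  [measurable : MeasurableSpace carrier]
  [borel : BorelSpace carrier]
  root : carrier
  μ : Measure carrier
  boundedlyFinite : ∀ s : Set carrier, Bornology.IsBounded s → μ s < ∞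

attribute [instance] MMSpace.metric MMSpace.complete MMSpace.separable MMSpace.measurable
  MMSpace.borel

namespace MMSpace

instance secondCountable (X : MMSpace) : SecondCountableTopology X.carrier :=
  UniformSpace.secondCountable_of_separable X.carrier

instance locallyFinite (X : MMSpace) : IsLocallyFiniteMeasure X.μ :=
  ⟨fun x => ⟨Metric.ball x 1, Metric.ball_mem_nhds x one_pos,
    X.boundedlyFinite _ Metric.isBounded_ball⟩⟩

/-- The set `supp(μ) ∪ {ρ}`. -/
def core (X : MMSpace) : Set X.carrier := X.μ.support ∪ {X.root}

/-- The root as a point of `supp(μ) ∪ {ρ}`. -/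
def coreRoot (X : MMSpace) : X.core := ⟨X.root, Or.inr rfl⟩

/-- The measure `μ` regarded as a measure on `supp(μ) ∪ {ρ}` (it gives no mass to the
complement of its support). -/
def coreMeasure (X : MMSpace) : Measure X.core := X.μ.comap Subtype.val

/-- Equivalence of metric measure spaces: a root-preserving and measure-preserving isometry
`supp(μ) ∪ {ρ} → supp(μ') ∪ {ρ'}`. -/
def Equivalent (X Y : MMSpace) : Prop :=
  ∃ φ : X.core ≃ᵢ Y.core, φ X.coreRoot = Y.coreRoot ∧ X.coreMeasure.map φ = Y.coreMeasure

theorem Equivalent.refl (X : MMSpace) : Equivalent X X :=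
  ⟨IsometryEquiv.refl _, rfl, Measure.map_id⟩

theorem Equivalent.symm {X Y : MMSpace} (h : Equivalent X Y) : Equivalent Y X := by
  obtain ⟨φ, h1, h2⟩ := h
  refine ⟨φ.symm, by rw [← h1, φ.symm_apply_apply], ?_⟩
  rw [← h2, Measure.map_map φ.symm.continuous.measurable φ.continuous.measurable]
  convert Measure.map_id
  ext x; simp

theorem Equivalent.trans {X Y Z : MMSpace} (h : Equivalent X Y) (h' : Equivalent Y Z) :
    Equivalent X Z := by
  obtain ⟨φ, h1, h2⟩ := h
  obtain ⟨ψ, h3, h4⟩ := h'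
  refine ⟨φ.trans ψ, by simp [h1, h3], ?_⟩
  rw [← h4, ← h2, Measure.map_map ψ.continuous.measurable φ.continuous.measurable]
  rfl

instance setoid : Setoid MMSpace := ⟨Equivalent, Equivalent.refl, Equivalent.symm, Equivalent.trans⟩

/-! Helper facts: equivalence in terms of isometric embeddings. -/

/-- An isometric embedding that preserves the root and the measure. -/
def IsEmb (X Y : MMSpace) (f : X.carrier → Y.carrier) : Prop :=
  Isometry f ∧ f X.root = Y.root ∧ X.μ.map f = Y.μ

theorem isClosed_core (X : MMSpace) : IsClosed X.core :=
  Measure.isClosed_support.union isClosed_singleton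

/-- The space `supp(μ) ∪ {ρ}` as a metric measure space of its own. -/
def coreSpace (X : MMSpace) : MMSpace :=
  haveI : CompleteSpace X.core := X.isClosed_core.completeSpace_coe
  { carrier := X.core
    root := X.coreRoot
    μ := X.coreMeasure
    boundedlyFinite := fun s hs => by
      rw [coreMeasure, comap_subtype_coe_apply X.isClosed_core.measurableSet]
      exact X.boundedlyFinite _ (isometry_subtype_coe.lipschitz.isBounded_image hs) }

theorem map_coreMeasure (X : MMSpace) : X.coreMeasure.map Subtype.val = X.μ := by
  rw [coreMeasure, map_comap_subtype_coe X.isClosed_core.measurableSet]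
  apply Measure.restrict_eq_self_of_ae_mem
  filter_upwards [Measure.support_mem_ae (μ := X.μ)] with x hx using Or.inl hx

theorem isEmb_coreSpace (X : MMSpace) : IsEmb X.coreSpace X (Subtype.val : X.core → X.carrier) :=
  ⟨isometry_subtype_coe, rfl, X.map_coreMeasure⟩

theorem Equivalent.exists_isEmb {X Y : MMSpace} (h : Equivalent X Y) :
    ∃ f, IsEmb X.coreSpace Y f := by
  obtain ⟨φ, h1, h2⟩ := h
  refine ⟨fun x : X.core => (φ x : Y.carrier), isometry_subtype_coe.comp φ.isometry, ?_, ?_⟩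
  · exact congrArg Subtype.val h1
  · rw [← Y.map_coreMeasure, ← h2,
      Measure.map_map measurable_subtype_coe φ.continuous.measurable]
    rfl

theorem IsEmb.measurable {X Y : MMSpace} {f : X.carrier → Y.carrier} (hf : IsEmb X Y f) :
    Measurable f := hf.1.continuous.measurable

theorem IsEmb.measure_closedBall {X Y : MMSpace} {f : X.carrier → Y.carrier} (hf : IsEmb X Y f)
    (x : X.carrier) (δ : ℝ) :
    Y.μ (Metric.closedBall (f x) δ) = X.μ (Metric.closedBall x δ) := by
  rw [← hf.2.2, Measure.map_apply hf.measurable Metric.isClosed_closedBall.measurableSet,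
    hf.1.preimage_closedBall]

theorem IsEmb.measure_ball {X Y : MMSpace} {f : X.carrier → Y.carrier} (hf : IsEmb X Y f)
    (x : X.carrier) (δ : ℝ) :
    Y.μ (Metric.ball (f x) δ) = X.μ (Metric.ball x δ) := by
  rw [← hf.2.2, Measure.map_apply hf.measurable Metric.isOpen_ball.measurableSet,
    hf.1.preimage_ball]

theorem IsEmb.image_support {X Y : MMSpace} {f : X.carrier → Y.carrier} (hf : IsEmb X Y f) :
    f '' X.μ.support = Y.μ.support := by
  have key : ∀ x, f x ∈ Y.μ.support ↔ x ∈ X.μ.support := by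
    intro x
    rw [Metric.nhds_basis_ball.mem_measureSupport, Metric.nhds_basis_ball.mem_measureSupport]
    simp only [hf.measure_ball]
  ext y
  constructor
  · rintro ⟨x, hx, rfl⟩
    exact (key x).2 hx
  · intro hy
    have hcl : IsClosed (range f) := hf.1.isClosedEmbedding.isClosed_range
    have hy' : y ∈ range f := by
      by_contra hcon
      have h0 := (Measure.mem_support_iff_forall y).1 hy _ (hcl.isOpen_compl.mem_nhds hcon)
      rw [← hf.2.2, Measure.map_apply hf.measurable hcl.measurableSet.compl] at h0
      simp at h0
    obtain ⟨x, rfl⟩ := hy'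
    exact ⟨x, (key x).1 hy, rfl⟩

theorem IsEmb.image_core {X Y : MMSpace} {f : X.carrier → Y.carrier} (hf : IsEmb X Y f) :
    f '' X.core = Y.core := by
  rw [core, core, image_union, hf.image_support, image_singleton, hf.2.1]

theorem IsEmb.equivalent {X Y : MMSpace} {f : X.carrier → Y.carrier} (hf : IsEmb X Y f) :
    Equivalent X Y := by
  have hmem : ∀ x : X.core, f x ∈ Y.core := fun x => hf.image_core ▸ ⟨x, x.2, rfl⟩
  let g : X.core → Y.core := fun x => ⟨f x, hmem x⟩
  have hg : Isometry g := fun x y => hf.1 x y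
  have hs : Function.Surjective g := by
    rintro ⟨y, hy⟩
    rw [← hf.image_core] at hy
    obtain ⟨x, hx, rfl⟩ := hy
    exact ⟨⟨x, hx⟩, rfl⟩
  refine ⟨⟨Equiv.ofBijective g ⟨hg.injective, hs⟩, hg⟩, Subtype.ext hf.2.1, ?_⟩
  change X.coreMeasure.map g = Y.coreMeasure
  have hval := MeasurableEmbedding.subtype_coe Y.isClosed_core.measurableSet
  have h : (X.coreMeasure.map g).map Subtype.val = Y.coreMeasure.map Subtype.val := by
    rw [Measure.map_map measurable_subtype_coe hg.continuous.measurable, map_coreMeasure,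
      ← hf.2.2, ← X.map_coreMeasure, Measure.map_map hf.measurable measurable_subtype_coe]
    rfl
  rw [← hval.comap_map (X.coreMeasure.map g), h, hval.comap_map]

/-- An invariant of measure-preserving isometric embeddings is an invariant of equivalence. -/
theorem Equivalent.invariant {α : Sort*} (F : MMSpace → α)
    (hF : ∀ X Y f, IsEmb X Y f → F X = F Y) {X Y : MMSpace} (h : Equivalent X Y) : F X = F Y := by
  obtain ⟨f, hf⟩ := h.exists_isEmb
  exact (hF _ _ _ X.isEmb_coreSpace).symm.trans (hF _ _ f hf)

/-! Constructions on spaces. -/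

/-- The restriction `(X, r, ρ, μ|_{closedBall ρ R})`. -/
def restr (R : ℝ) (X : MMSpace) : MMSpace where
  carrier := X.carrier
  root := X.root
  μ := X.μ.restrict (Metric.closedBall X.root R)
  boundedlyFinite := fun s hs => (Measure.restrict_apply_le _ s).trans_lt (X.boundedlyFinite s hs)

theorem IsEmb.restr {X Y : MMSpace} {f : X.carrier → Y.carrier} (hf : IsEmb X Y f) (R : ℝ) :
    IsEmb (X.restr R) (Y.restr R) f := by
  refine ⟨hf.1, hf.2.1, ?_⟩
  change (X.μ.restrict (Metric.closedBall X.root R)).map f =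
    Y.μ.restrict (Metric.closedBall Y.root R)
  rw [← hf.2.2, Measure.restrict_map hf.measurable Metric.isClosed_closedBall.measurableSet,
    ← hf.2.1, hf.1.preimage_closedBall]

/-- The index set of the entries `(i, j)`, `0 ≤ i < j ≤ m`, of a distance matrix. -/
abbrev Pairs (m : ℕ) : Type := {p : Fin (m + 1) × Fin (m + 1) // p.1 < p.2}

/-- The distances `(r(x_i, x_j))_{0 ≤ i < j ≤ m}` with `x_0 = ρ`. -/
def dists (X : MMSpace) (m : ℕ) (x : Fin m → X.carrier) : Pairs m → ℝ≥0 :=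
  fun p => nndist ((Fin.cons X.root x : Fin (m + 1) → X.carrier) p.1.1)
    ((Fin.cons X.root x : Fin (m + 1) → X.carrier) p.1.2)

/-- The `m`-point distance matrix distribution. -/
def distMat (m : ℕ) (X : MMSpace) : Measure (Pairs m → ℝ≥0) :=
  (Measure.pi fun _ : Fin m => X.μ).map (X.dists m)

theorem measurable_dists (X : MMSpace) (m : ℕ) : Measurable (X.dists m) := by
  have h : ∀ i : Fin (m + 1),
      Continuous fun x : Fin m → X.carrier => (Fin.cons X.root x : Fin (m + 1) → X.carrier) i := by
    intro i
    refine Fin.cases ?_ (fun j => ?_) i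
    · simpa using continuous_const
    · simpa using continuous_apply j
  have h' : Continuous (X.dists m) :=
    continuous_pi fun p : Pairs m => (h p.1.1).nndist (h p.1.2)
  exact h'.measurable

theorem IsEmb.distMat_eq {X Y : MMSpace} {f : X.carrier → Y.carrier} (hf : IsEmb X Y f) (m : ℕ) :
    X.distMat m = Y.distMat m := by
  have hsf : SigmaFinite (X.μ.map f) := by rw [hf.2.2]; infer_instance
  have h1 : (Measure.pi fun _ : Fin m => Y.μ) =
      (Measure.pi fun _ : Fin m => X.μ).map fun x i => f (x i) := by
    rw [Measure.pi_map_pi (fun _ => hf.measurable.aemeasurable), hf.2.2]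
  have h2 : Measurable fun (x : Fin m → X.carrier) (i : Fin m) => f (x i) :=
    measurable_pi_lambda _ fun i => hf.measurable.comp (measurable_pi_apply i)
  rw [distMat, distMat, h1, Measure.map_map (Y.measurable_dists m) h2]
  congr 1
  funext x p
  have h3 : ∀ i : Fin (m + 1),
      (Fin.cons Y.root (fun i => f (x i)) : Fin (m + 1) → Y.carrier) i =
        f ((Fin.cons X.root x : Fin (m + 1) → X.carrier) i) := by
    intro i
    refine Fin.cases ?_ (fun j => ?_) i
    · simp [hf.2.1]
    · simp
  simp only [dists, Function.comp, h3, hf.1.nndist_eq]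

/-- The lower mass function: the infimum (in `[0, ∞]`, with `inf ∅ = ∞`) of the masses
`μ(closedBall x δ)` over `x ∈ ball ρ R ∩ supp(μ)`. -/
def lowerMass (δ R : ℝ) (X : MMSpace) : ℝ≥0∞ :=
  ⨅ x ∈ Metric.ball X.root R ∩ X.μ.support, X.μ (Metric.closedBall x δ)

theorem IsEmb.lowerMass_eq {X Y : MMSpace} {f : X.carrier → Y.carrier} (hf : IsEmb X Y f)
    (δ R : ℝ) : X.lowerMass δ R = Y.lowerMass δ R := by
  have h : Metric.ball Y.root R ∩ Y.μ.support = f '' (Metric.ball X.root R ∩ X.μ.support) := by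
    rw [← hf.image_support, ← hf.2.1, ← hf.1.preimage_ball, image_preimage_inter]
  rw [lowerMass, lowerMass, h, iInf_image]
  simp only [hf.measure_closedBall]

/-- The mass `μ(ball ρ R)` of the open ball of radius `R` around the root. -/
def ballMass (R : ℝ) (X : MMSpace) : ℝ≥0∞ := X.μ (Metric.ball X.root R)

theorem IsEmb.ballMass_eq {X Y : MMSpace} {f : X.carrier → Y.carrier} (hf : IsEmb X Y f)
    (R : ℝ) : X.ballMass R = Y.ballMass R := by
  rw [ballMass, ballMass, ← hf.2.1, hf.measure_ball]

/-- The total mass `μ(X)`. -/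
def mass (X : MMSpace) : ℝ≥0∞ := X.μ univ

theorem IsEmb.mass_eq {X Y : MMSpace} {f : X.carrier → Y.carrier} (hf : IsEmb X Y f) :
    X.mass = Y.mass := by
  rw [mass, mass, ← hf.2.2, Measure.map_apply hf.measurable MeasurableSet.univ, preimage_univ]

theorem isFiniteMeasure_distMat (X : MMSpace) (m : ℕ) (h : X.mass < ∞) :
    IsFiniteMeasure (X.distMat m) := by
  have : IsFiniteMeasure X.μ := ⟨h⟩
  unfold distMat
  infer_instance

theorem mass_restr_lt_top (X : MMSpace) (R : ℝ) : (X.restr R).mass < ∞ := by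
  change (X.μ.restrict (Metric.closedBall X.root R)) univ < ∞
  rw [Measure.restrict_apply_univ]
  exact X.boundedlyFinite _ Metric.isBounded_closedBall

end MMSpace

/-- The set `𝕏` of equivalence classes of metric boundedly finite measure spaces. -/
def MM : Type 1 := Quotient MMSpace.setoid

namespace MM

/-- The total mass of (any representative of) an equivalence class. -/
def mass (𝒳 : MM) : ℝ≥0∞ :=
  Quotient.lift MMSpace.mass
    (fun _ _ h => MMSpace.Equivalent.invariant _ (fun _ _ _ hf => hf.mass_eq) h) 𝒳

/-- The mass of the open ball of radius `R` around the root. -/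
def ballMass (R : ℝ) (𝒳 : MM) : ℝ≥0∞ :=
  Quotient.lift (MMSpace.ballMass R)
    (fun _ _ h => MMSpace.Equivalent.invariant _ (fun _ _ _ hf => hf.ballMass_eq R) h) 𝒳

/-- The lower mass function on equivalence classes. -/
def lowerMass (δ R : ℝ) (𝒳 : MM) : ℝ≥0∞ :=
  Quotient.lift (MMSpace.lowerMass δ R)
    (fun _ _ h => MMSpace.Equivalent.invariant _ (fun _ _ _ hf => hf.lowerMass_eq δ R) h) 𝒳

/-- The `m`-point distance matrix distribution of an equivalence class. -/
def distMat (m : ℕ) (𝒳 : MM) : Measure (MMSpace.Pairs m → ℝ≥0) :=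
  Quotient.lift (MMSpace.distMat m)
    (fun _ _ h => MMSpace.Equivalent.invariant _ (fun _ _ _ hf => hf.distMat_eq m) h) 𝒳

theorem isFiniteMeasure_distMat (𝒳 : MM) (m : ℕ) (h : 𝒳.mass < ∞) :
    IsFiniteMeasure (𝒳.distMat m) := by
  induction 𝒳 using Quotient.inductionOn with
  | h X => exact X.isFiniteMeasure_distMat m h

end MM

/-- The set of (equivalence classes of) metric finite measure spaces. -/
structure MMFin where
  toMM : MM
  mass_lt_top : toMM.mass < ∞

namespace MMFin

/-- The `m`-point distance matrix distribution as a finite measure. -/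
def distMat (m : ℕ) (𝒳 : MMFin) : FiniteMeasure (MMSpace.Pairs m → ℝ≥0) :=
  ⟨𝒳.toMM.distMat m, 𝒳.toMM.isFiniteMeasure_distMat m 𝒳.mass_lt_top⟩

/-- The Gromov-weak topology: the coarsest topology for which all distance matrix distributions
are continuous with respect to weak convergence of finite measures. -/
instance gromovWeak : TopologicalSpace MMFin :=
  ⨅ m : ℕ, TopologicalSpace.induced (distMat m) inferInstance

end MMFin

namespace MM

/-- The restriction `𝒳|_R` to the closed ball of radius `R` around the root. -/
def restr (R : ℝ) (𝒳 : MM) : MMFin :=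
  Quotient.lift
    (fun X : MMSpace => (⟨(Quotient.mk _ (X.restr R) : MM), X.mass_restr_lt_top R⟩ : MMFin))
    (fun _ _ h => MMSpace.Equivalent.invariant
      (fun X : MMSpace => (⟨(Quotient.mk _ (X.restr R) : MM), X.mass_restr_lt_top R⟩ : MMFin))
      (fun _ _ _ hf => MMFin.mk.injEq .. ▸ Quotient.sound (hf.restr R).equivalent) h) 𝒳

/-- Gromov-vague convergence of a sequence: Gromov-weak convergence of the restrictions to closed
balls of radius `R`, for all but countably many `R > 0`. -/
def GVConverges (u : ℕ → MM) (𝒳 : MM) : Prop :=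
  {R : ℝ | 0 < R ∧ ¬ Tendsto (fun n => (u n).restr R) atTop (𝓝 (𝒳.restr R))}.Countable

/-- The Gromov-vague topology, given by its convergent sequences: a set `U` is open iff every
sequence that converges Gromov-vaguely to a point of `U` is eventually in `U`. -/
instance gromovVague : TopologicalSpace MM where
  IsOpen U := ∀ (u : ℕ → MM) (𝒳 : MM), 𝒳 ∈ U → GVConverges u 𝒳 → ∀ᶠ n in atTop, u n ∈ U
  isOpen_univ := fun _ _ _ _ => Eventually.of_forall fun _ => mem_univ _
  isOpen_inter := fun _ _ hU hV u 𝒳 h𝒳 hu => (hU u 𝒳 h𝒳.1 hu).and (hV u 𝒳 h𝒳.2 hu)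
  isOpen_sUnion := fun _ hS u 𝒳 ⟨U, hU, h𝒳⟩ hu =>
    (hS U hU u 𝒳 h𝒳 hu).mono fun _ hn => ⟨U, hU, hn⟩

/-- The set `𝕏_HB` of equivalence classes that contain a Heine-Borel space. -/
def XHB : Set MM :=
  {𝒳 | ∃ X : MMSpace, (Quotient.mk _ X : MM) = 𝒳 ∧ ProperSpace X.carrier}

/-- The local lower mass-bound property of a set of metric boundedly finite measure spaces. -/
def LocalLowerMassBound (K : Set MM) : Prop :=
  ∀ R δ : ℝ, 0 < δ → δ < R → 0 < ⨅ 𝒳 ∈ K, lowerMass δ R 𝒳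

end MM

/-- A subset of a topological space is relatively compact if its closure is compact. -/
def RelativelyCompact {α : Type*} [TopologicalSpace α] (K : Set α) : Prop :=
  IsCompact (closure K)

end GromovVague

end

/-!
Everything is reduced to sequences and to approximation by finitely many points.

*The topology.* Multiplying the measure by a bounded continuous function of the distance to the root
multiplies the distance matrix distributions by a bounded continuous function, so it preserves
Gromov-weak convergence (`GromovWeak.weight`). Hence Gromov-vague convergence is Gromov-weak
convergence of the spaces cut off continuously at each radius (`gvConverges_iff`): a Gromov-weak
limit charges only countably many spheres around the root. The topology given by the convergent
sequences is therefore the one induced by the cutoffs (`MM.isInducing_cut`). Both topologies are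
pseudo-metrizable, and relative compactness means that every sequence has a convergent subsequence
(`relativelyCompact_iff_forall_seq`).

*Finite spaces.* Relative compactness amounts to uniform approximability, `IsApprox`: for each `ε`
there is `N` such that every space has mass at most `N` and, up to mass `ε`, lies within `ε` of `N`
points in the ball of radius `N`. It is sufficient (`exists_subseq_gromovWeak`): along a subsequence
the distances between the approximating points converge, the limiting pseudo-metric has a Polish
completion, and the images of the measures under nearest point maps are tight there. It is necessary
(`GromovWeak.eventually_isApprox`): the mass missed by the `ε`-balls around `N` random points is,
essentially, the integral of a continuous function of a distance matrix, it is small for the limit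
space, and so it is small along the sequence.

*Locally finite spaces.* If the restrictions to all balls are uniformly approximable, then so are
the whole spaces after multiplication by a suitable positive radial weight that decays fast; the
weight is divided out of the Gromov-weak limit (`exists_subseq_gromovWeak_cutoff`). Approximability
passes to restrictions, which gives the three equivalent conditions (`relativelyCompact_tfae`).

*Heine–Borel spaces.* Balls of radius `δ / 2` around points of the support at pairwise distance
greater than `δ` are disjoint, so upper and lower mass bounds limit the number of such points in a
ball (`exists_forall_not_pairwise_lt_dist`). A maximal family of such points gives the
approximation. The bound on their number passes to limits, as it is the vanishing of an integral of
a continuous function of a distance matrix (`not_pairwise_lt_dist_of_gromovWeak`); so the balls of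
the support of the limit are totally bounded (`toMM_mem_XHB`).
-/

namespace GromovVague

/-! ### Weak convergence of finite measures -/

section FiniteMeasure

open scoped BoundedContinuousFunction

variable {Ω : Type*} [MeasurableSpace Ω]

theorem tendsto_add_const_iff [TopologicalSpace Ω] [OpensMeasurableSpace Ω] {γ : Type*}
    {F : Filter γ} {μs : γ → FiniteMeasure Ω} {μ ν : FiniteMeasure Ω} :
    Tendsto (fun i => μs i + ν) F (𝓝 (μ + ν)) ↔ Tendsto μs F (𝓝 μ) := by
  refine ⟨fun h => ?_, fun h => h.add tendsto_const_nhds⟩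
  rw [FiniteMeasure.tendsto_iff_forall_testAgainstNN_tendsto] at h ⊢
  intro f
  have := (h f).sub_const (ν.testAgainstNN f)
  have hadd : ∀ κ : FiniteMeasure Ω,
      (κ + ν).testAgainstNN f - ν.testAgainstNN f = κ.testAgainstNN f := by
    intro κ
    have : (κ + ν).testAgainstNN f = κ.testAgainstNN f + ν.testAgainstNN f := by
      rw [← ENNReal.coe_inj, ENNReal.coe_add]
      simp only [FiniteMeasure.testAgainstNN_coe_eq, FiniteMeasure.toMeasure_add,
        lintegral_add_measure]
    rw [this, add_tsub_cancel_right]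
  simpa only [hadd] using this

/-- The unit mass at `a`, as a finite measure. -/
noncomputable def diracFinite (a : Ω) : FiniteMeasure Ω := ⟨Measure.dirac a, inferInstance⟩

/-- The normalisation of `μ + δ_a`, together with the total mass of `μ + δ_a`. As `μ + δ_a ≠ 0`,
nothing is lost when `μ` itself is zero, so facts about weak convergence of probability measures
carry over to all finite measures. -/
noncomputable def addDiracNormalize [Nonempty Ω] (a : Ω) (μ : FiniteMeasure Ω) :
    ProbabilityMeasure Ω × ℝ≥0 :=
  ((μ + diracFinite a).normalize, (μ + diracFinite a).mass)

theorem mass_add_diracFinite (a : Ω) (μ : FiniteMeasure Ω) :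
    (μ + diracFinite a).mass = μ.mass + 1 := by
  rw [← ENNReal.coe_inj, ENNReal.coe_add, FiniteMeasure.ennreal_mass, FiniteMeasure.ennreal_mass,
    FiniteMeasure.toMeasure_add, Measure.add_apply]
  congr 1
  exact measure_univ (μ := Measure.dirac a)

theorem add_diracFinite_ne_zero (a : Ω) (μ : FiniteMeasure Ω) : μ + diracFinite a ≠ 0 := by
  rw [← FiniteMeasure.mass_nonzero_iff, mass_add_diracFinite]
  positivity

theorem isInducing_addDiracNormalize [TopologicalSpace Ω] [OpensMeasurableSpace Ω] [Nonempty Ω]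
    (a : Ω) : IsInducing (addDiracNormalize a) := by
  have key : ∀ (F : Filter (FiniteMeasure Ω)) (μ : FiniteMeasure Ω),
      Tendsto (addDiracNormalize a) F (𝓝 (addDiracNormalize a μ)) ↔ F ≤ 𝓝 μ := by
    intro F μ
    rw [← tendsto_id', ← tendsto_add_const_iff (ν := diracFinite a),
      ← FiniteMeasure.tendsto_normalize_iff_tendsto (add_diracFinite_ne_zero a μ),
      Prod.tendsto_iff]
    rfl
  refine isInducing_iff_nhds.2 fun μ => le_antisymm ?_ ?_
  · exact tendsto_iff_comap.1 ((key _ _).2 le_rfl)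
  · exact (key _ _).1 tendsto_comap

theorem pseudoMetrizableSpace_finiteMeasure [TopologicalSpace Ω]
    [TopologicalSpace.PseudoMetrizableSpace Ω] [TopologicalSpace.SeparableSpace Ω]
    [OpensMeasurableSpace Ω] [Nonempty Ω] :
    TopologicalSpace.PseudoMetrizableSpace (FiniteMeasure Ω) :=
  (isInducing_addDiracNormalize (Classical.arbitrary Ω)).pseudoMetrizableSpace

/-- Weak convergence of finite measures can be tested on bounded Lipschitz functions. -/
theorem tendsto_finiteMeasure_of_forall_lipschitz [PseudoEMetricSpace Ω] [OpensMeasurableSpace Ω]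
    [Nonempty Ω] {γ : Type*} {F : Filter γ} [F.IsCountablyGenerated]
    {μs : γ → FiniteMeasure Ω} {μ : FiniteMeasure Ω}
    (h : ∀ f : Ω → ℝ, (∃ C : ℝ, ∀ x, |f x| ≤ C) → (∃ L, LipschitzWith L f) →
      Tendsto (fun i => ∫ x, f x ∂(μs i : Measure Ω)) F (𝓝 (∫ x, f x ∂(μ : Measure Ω)))) :
    Tendsto μs F (𝓝 μ) := by
  set a : Ω := Classical.arbitrary Ω
  have hne := add_diracFinite_ne_zero a
  have hm : Tendsto (fun i => (μs i + diracFinite a).mass) F (𝓝 (μ + diracFinite a).mass) := by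
    have h1 := h (fun _ => 1) ⟨1, by simp⟩ ⟨0, LipschitzWith.const 1⟩
    simp only [integral_const, smul_eq_mul, mul_one] at h1
    have h2 : ∀ ν : FiniteMeasure Ω,
        ((ν + diracFinite a).mass : ℝ) = (ν : Measure Ω).real univ + 1 := by
      intro ν
      rw [mass_add_diracFinite]
      rfl
    rw [← NNReal.tendsto_coe]
    simp only [h2]
    exact h1.add_const 1
  rw [← tendsto_add_const_iff (ν := diracFinite a),
    ← FiniteMeasure.tendsto_normalize_iff_tendsto (hne μ)]
  refine ⟨?_, hm⟩
  rw [tendsto_iff_forall_lipschitz_integral_tendsto]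
  rintro f ⟨C, hC⟩ ⟨L, hL⟩
  have hb : ∀ x, |f x| ≤ C + |f a| := fun x => by
    have := hC x a
    rw [Real.dist_eq] at this
    calc |f x| = |(f x - f a) + f a| := by ring_nf
      _ ≤ _ := (abs_add_le _ _).trans (by linarith)
  have hint : ∀ ν : Measure Ω, IsFiniteMeasure ν → Integrable f ν := fun ν _ =>
    Integrable.of_bound hL.continuous.measurable.aestronglyMeasurable (C + |f a|)
      (Eventually.of_forall hb)
  have hf : ∀ ν : FiniteMeasure Ω, ∫ x, f x ∂((ν + diracFinite a).normalize : Measure Ω) =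
      ((ν + diracFinite a).mass : ℝ)⁻¹ * (∫ x, f x ∂(ν : Measure Ω) + f a) := by
    intro ν
    rw [FiniteMeasure.toMeasure_normalize_eq_of_nonzero _ (hne ν), integral_smul_nnreal_measure,
      FiniteMeasure.toMeasure_add,
      integral_add_measure (hint _ inferInstance) (hint _ inferInstance)]
    have : ∫ x, f x ∂(diracFinite a : Measure Ω) = f a :=
      integral_dirac' _ _ hL.continuous.measurable.stronglyMeasurable
    rw [this]
    rfl
  simp only [hf]
  refine Tendsto.mul (Tendsto.inv₀ (NNReal.tendsto_coe.2 hm) ?_)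
    ((h f ⟨_, hb⟩ ⟨L, hL⟩).add_const _)
  exact_mod_cast (FiniteMeasure.mass_nonzero_iff _).2 (hne μ)

theorem finiteMeasure_pi_eq_smul [Nonempty Ω] (m : ℕ) (μ : FiniteMeasure Ω) :
    FiniteMeasure.pi (fun _ : Fin m => μ) =
      μ.mass ^ m • (ProbabilityMeasure.pi fun _ : Fin m => μ.normalize).toFiniteMeasure := by
  apply FiniteMeasure.toMeasure_injective
  simp only [FiniteMeasure.toMeasure_pi]
  refine Measure.pi_eq fun s hs => ?_
  have h1 : ∀ i, (μ : Measure Ω) (s i) = (μ.mass : ℝ≥0∞) * (μ.normalize : Measure Ω) (s i) := by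
    intro i
    conv_lhs => rw [μ.self_eq_mass_smul_normalize]
    rfl
  simp only [h1, Finset.prod_mul_distrib]
  have h2 : ((μ.mass ^ m • (ProbabilityMeasure.pi fun _ : Fin m => μ.normalize).toFiniteMeasure :
      FiniteMeasure (Fin m → Ω)) : Measure (Fin m → Ω)) =
      (μ.mass ^ m) • Measure.pi fun _ : Fin m => (μ.normalize : Measure Ω) := rfl
  rw [h2, Measure.smul_apply, Measure.pi_pi]
  simp [ENNReal.smul_def]

theorem tendsto_finiteMeasure_pi [TopologicalSpace Ω] [OpensMeasurableSpace Ω] [Nonempty Ω]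
    [SecondCountableTopology Ω] [TopologicalSpace.PseudoMetrizableSpace Ω]
    {γ : Type*} {F : Filter γ} {μs : γ → FiniteMeasure Ω} {μ : FiniteMeasure Ω}
    (h : Tendsto μs F (𝓝 μ)) (m : ℕ) :
    Tendsto (fun i => FiniteMeasure.pi (fun _ : Fin m => μs i)) F
      (𝓝 (FiniteMeasure.pi fun _ : Fin m => μ)) := by
  rcases Nat.eq_zero_or_pos m with rfl | hm
  · have : ∀ ν : FiniteMeasure Ω, FiniteMeasure.pi (fun _ : Fin 0 => ν) =
        FiniteMeasure.pi fun _ : Fin 0 => μ := fun ν => by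
      congr 1; exact Subsingleton.elim _ _
    simp only [this]
    exact tendsto_const_nhds
  by_cases h0 : μ = 0
  · have h1 : FiniteMeasure.pi (fun _ : Fin m => μ) = 0 := by
      rw [← FiniteMeasure.mass_zero_iff]
      simp [h0, hm.ne']
    rw [h1]
    apply FiniteMeasure.tendsto_zero_of_tendsto_zero_mass
    have := h.mass.pow m
    simpa [h0, hm.ne'] using this
  · obtain ⟨h1, h2⟩ := (FiniteMeasure.tendsto_normalize_iff_tendsto h0).2 h
    have h3 : Tendsto (fun i => ProbabilityMeasure.pi fun _ : Fin m => (μs i).normalize) F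
        (𝓝 (ProbabilityMeasure.pi fun _ : Fin m => μ.normalize)) :=
      (ProbabilityMeasure.continuous_pi.tendsto _).comp (tendsto_pi_nhds.2 fun _ => h1)
    simp only [finiteMeasure_pi_eq_smul]
    exact (h2.pow m).smul ((ProbabilityMeasure.toFiniteMeasure_continuous.tendsto _).comp h3)

theorem tendsto_finiteMeasure_of_null_frontier [TopologicalSpace Ω] [OpensMeasurableSpace Ω]
    [HasOuterApproxClosed Ω] [Nonempty Ω]
    {γ : Type*} {F : Filter γ} {μs : γ → FiniteMeasure Ω} {μ : FiniteMeasure Ω}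
    (h : Tendsto μs F (𝓝 μ)) {E : Set Ω} (hE : (μ : Measure Ω) (frontier E) = 0) :
    Tendsto (fun i => (μs i : Measure Ω) E) F (𝓝 ((μ : Measure Ω) E)) := by
  simp only [← FiniteMeasure.ennreal_coeFn_eq_coeFn_toMeasure]
  rw [ENNReal.tendsto_coe]
  by_cases h0 : μ = 0
  · subst h0
    have := h.mass
    refine tendsto_of_tendsto_of_tendsto_of_le_of_le tendsto_const_nhds ?_ (fun _ => zero_le)
      (fun i => (μs i).apply_le_mass E)
    simpa using this
  · obtain ⟨h1, h2⟩ := (FiniteMeasure.tendsto_normalize_iff_tendsto h0).2 h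
    have h3 := ProbabilityMeasure.tendsto_measure_of_null_frontier_of_tendsto h1 (E := E) (by
      rw [ProbabilityMeasure.null_iff_toMeasure_null,
        FiniteMeasure.toMeasure_normalize_eq_of_nonzero _ h0]
      simp [hE])
    have := h2.mul h3
    simpa only [← FiniteMeasure.self_eq_mass_mul_normalize] using this

/-- Convergence of integrals over a set whose frontier is not charged by the limit. -/
theorem tendsto_setLIntegral_of_null_frontier [TopologicalSpace Ω] [OpensMeasurableSpace Ω]
    [HasOuterApproxClosed Ω] [Nonempty Ω]
    {γ : Type*} {F : Filter γ} {μs : γ → FiniteMeasure Ω} {μ : FiniteMeasure Ω}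
    (h : Tendsto μs F (𝓝 μ)) {E : Set Ω} (hm : MeasurableSet E)
    (hE : (μ : Measure Ω) (frontier E) = 0) (f : Ω →ᵇ ℝ≥0) :
    Tendsto (fun i => ∫⁻ x in E, f x ∂(μs i : Measure Ω)) F
      (𝓝 (∫⁻ x in E, f x ∂(μ : Measure Ω))) := by
  have hfin : ∀ ν : FiniteMeasure Ω,
      IsFiniteMeasure ((ν : Measure Ω).withDensity fun x => (f x : ℝ≥0∞)) := fun ν =>
    isFiniteMeasure_withDensity (f.lintegral_lt_top_of_nnreal _).ne
  let D : FiniteMeasure Ω → FiniteMeasure Ω := fun ν => ⟨_, hfin ν⟩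
  have hmeas : Measurable fun x => (f x : ℝ≥0∞) := f.continuous.measurable.coe_nnreal_ennreal
  have hD : Tendsto (fun i => D (μs i)) F (𝓝 (D μ)) := by
    rw [FiniteMeasure.tendsto_iff_forall_lintegral_tendsto] at h ⊢
    intro g
    have : ∀ ν : FiniteMeasure Ω, ∫⁻ x, g x ∂(D ν : Measure Ω) =
        ∫⁻ x, ((f * g) x : ℝ≥0) ∂(ν : Measure Ω) := by
      intro ν
      change ∫⁻ x, g x ∂((ν : Measure Ω).withDensity fun x => (f x : ℝ≥0∞)) = _
      rw [lintegral_withDensity_eq_lintegral_mul _ hmeas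
        g.continuous.measurable.coe_nnreal_ennreal]
      simp
    simp only [this]
    exact h (f * g)
  have := tendsto_finiteMeasure_of_null_frontier hD (E := E)
    ((withDensity_absolutelyContinuous _ _) hE)
  have h2 : ∀ ν : FiniteMeasure Ω, (D ν : Measure Ω) E = ∫⁻ x in E, f x ∂(ν : Measure Ω) :=
    fun ν => withDensity_apply _ hm
  simpa only [h2] using this

end FiniteMeasure

section Products

theorem lintegral_fin_prod_eq_prod {m : ℕ} {Ω : Type*} [MeasurableSpace Ω] (μ : Measure Ω)
    [SigmaFinite μ] {f : Fin m → Ω → ℝ≥0∞} (hf : ∀ i, Measurable (f i)) :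
    ∫⁻ x, ∏ i, f i (x i) ∂(Measure.pi fun _ : Fin m => μ) = ∏ i, ∫⁻ x, f i x ∂μ := by
  induction m with
  | zero => simp
  | succ m ih =>
    have hmp := (measurePreserving_piFinSuccAbove (fun _ : Fin (m + 1) => μ) 0).symm
    have hmeas : Measurable fun x : Fin (m + 1) → Ω => ∏ i, f i (x i) :=
      Finset.measurable_prod _ fun i _ => (hf i).comp (measurable_pi_apply i)
    rw [← hmp.lintegral_comp hmeas]
    have hm2 : Measurable fun y : Fin m → Ω => ∏ i, f (Fin.succ i) (y i) :=
      Finset.measurable_prod _ fun i _ => (hf _).comp (measurable_pi_apply i)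
    rw [Fin.prod_univ_succ, ← ih (fun i => hf i.succ),
      ← lintegral_prod_mul (hf 0).aemeasurable hm2.aemeasurable]
    simp [Fin.prod_univ_succ, MeasurableEquiv.piFinSuccAbove, Fin.insertNthEquiv]

theorem pi_withDensity_fin {m : ℕ} {Ω : Type*} [MeasurableSpace Ω] (μ : Measure Ω)
    [SigmaFinite μ] {f : Ω → ℝ≥0} (hf : Measurable f) :
    Measure.pi (fun _ : Fin m => μ.withDensity fun x => (f x : ℝ≥0∞)) =
      (Measure.pi fun _ : Fin m => μ).withDensity fun x => ∏ i, (f (x i) : ℝ≥0∞) := by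
  refine Measure.pi_eq fun s hs => ?_
  rw [withDensity_apply _ (MeasurableSet.univ_pi hs),
    ← lintegral_indicator (MeasurableSet.univ_pi hs)]
  have : ∀ x : Fin m → Ω, (univ.pi s).indicator (fun x => ∏ i, (f (x i) : ℝ≥0∞)) x =
      ∏ i, (s i).indicator (fun x => (f x : ℝ≥0∞)) (x i) := by
    intro x
    by_cases hx : x ∈ univ.pi s
    · rw [indicator_of_mem hx]
      exact Finset.prod_congr rfl fun i _ =>
        (indicator_of_mem (hx i trivial) (f := fun x => (f x : ℝ≥0∞))).symm
    · rw [indicator_of_notMem hx]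
      simp only [Set.mem_pi, mem_univ, forall_true_left, not_forall] at hx
      obtain ⟨i, hi⟩ := hx
      exact (Finset.prod_eq_zero (Finset.mem_univ i) (indicator_of_notMem hi _)).symm
  simp only [this]
  rw [lintegral_fin_prod_eq_prod μ fun i => hf.coe_nnreal_ennreal.indicator (hs i)]
  refine Finset.prod_congr rfl fun i _ => ?_
  rw [lintegral_indicator (hs i), withDensity_apply _ (hs i)]

end Products

/-! ### Relative compactness in pseudo-metrizable spaces -/

theorem relativelyCompact_iff_forall_seq {α : Type*} [TopologicalSpace α]
    [TopologicalSpace.PseudoMetrizableSpace α] {K : Set α} :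
    RelativelyCompact K ↔ ∀ u : ℕ → α, (∀ n, u n ∈ K) →
      ∃ (a : α) (φ : ℕ → ℕ), StrictMono φ ∧ Tendsto (u ∘ φ) atTop (𝓝 a) := by
  let _ := TopologicalSpace.pseudoMetrizableSpacePseudoMetric α
  constructor
  · intro h u hu
    obtain ⟨a, -, φ, hφ, ha⟩ := h.tendsto_subseq fun n => subset_closure (hu n)
    exact ⟨a, φ, hφ, ha⟩
  · intro h
    refine IsSeqCompact.isCompact fun v hv => ?_
    have : ∀ n : ℕ, ∃ b ∈ K, dist (v n) b < 1 / ((n : ℝ) + 1) := fun n =>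
      Metric.mem_closure_iff.1 (hv n) _ Nat.one_div_pos_of_nat
    choose u huK hu using this
    obtain ⟨a, φ, hφ, ha⟩ := h u huK
    refine ⟨a, mem_closure_of_tendsto ha (Eventually.of_forall fun n => huK _), φ, hφ, ?_⟩
    refine (tendsto_iff_of_dist ?_).2 ha
    refine squeeze_zero (fun _ => dist_nonneg) (fun n => (hu (φ n)).le) ?_
    exact tendsto_one_div_add_atTop_nhds_zero_nat.comp hφ.tendsto_atTop

theorem pseudoMetrizableSpace_pi_countable {ι : Type*} [Countable ι] {E : ι → Type*}
    [∀ i, TopologicalSpace (E i)] [∀ i, TopologicalSpace.PseudoMetrizableSpace (E i)] :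
    TopologicalSpace.PseudoMetrizableSpace (∀ i, E i) := by
  let _ := fun i => TopologicalSpace.pseudoMetrizableSpacePseudoMetric (E i)
  exact UniformSpace.pseudoMetrizableSpace

/-! ### Gromov-weak convergence of sequences -/

namespace MMFin

theorem isInducing_distMat : IsInducing fun (𝒳 : MMFin) (m : ℕ) => 𝒳.distMat m := by
  constructor
  simp only [gromovWeak, Pi.topologicalSpace, induced_iInf, induced_compose]
  rfl

instance : TopologicalSpace.PseudoMetrizableSpace MMFin := by
  have : ∀ m, TopologicalSpace.PseudoMetrizableSpace
      (FiniteMeasure (MMSpace.Pairs m → ℝ≥0)) := fun _ => pseudoMetrizableSpace_finiteMeasure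
  have := pseudoMetrizableSpace_pi_countable
    (E := fun m : ℕ => FiniteMeasure (MMSpace.Pairs m → ℝ≥0))
  exact isInducing_distMat.pseudoMetrizableSpace

end MMFin

namespace MMSpace

open scoped BoundedContinuousFunction

/-- The equivalence class of a space. -/
def toMM (X : MMSpace) : MM := Quotient.mk _ X

/-- The class of a space of finite total mass. -/
def toFin (X : MMSpace) (h : X.mass < ∞) : MMFin := ⟨X.toMM, h⟩

/-- Gromov-weak convergence of a sequence of spaces, stated on representatives through integrals
of bounded continuous functions of the sampled distances. -/
def GromovWeak (X : ℕ → MMSpace) (Y : MMSpace) : Prop :=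
  ∀ (m : ℕ) (f : (Pairs m → ℝ≥0) →ᵇ ℝ≥0),
    Tendsto (fun n => ∫⁻ d, f d ∂((X n).distMat m)) atTop (𝓝 (∫⁻ d, f d ∂(Y.distMat m)))

theorem tendsto_toFin_iff {X : ℕ → MMSpace} {Y : MMSpace} (hX : ∀ n, (X n).mass < ∞)
    (hY : Y.mass < ∞) :
    Tendsto (fun n => (X n).toFin (hX n)) atTop (𝓝 (Y.toFin hY)) ↔ GromovWeak X Y := by
  rw [MMFin.isInducing_distMat.tendsto_nhds_iff, tendsto_pi_nhds]
  refine forall_congr' fun m => ?_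
  exact FiniteMeasure.tendsto_iff_forall_lintegral_tendsto

theorem GromovWeak.tendsto_distMat {X : ℕ → MMSpace} {Y : MMSpace} (h : GromovWeak X Y)
    (hX : ∀ n, (X n).mass < ∞) (hY : Y.mass < ∞) (m : ℕ) :
    Tendsto (fun n => ((X n).toFin (hX n)).distMat m) atTop (𝓝 ((Y.toFin hY).distMat m)) :=
  FiniteMeasure.tendsto_iff_forall_lintegral_tendsto.2 (h m)

/-- The full symmetric matrix of distances between the root and `m` points. -/
def distMatrix (X : MMSpace) (m : ℕ) (x : Fin m → X.carrier) : Fin (m + 1) → Fin (m + 1) → ℝ≥0 :=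
  fun i j => nndist ((Fin.cons X.root x : Fin (m + 1) → X.carrier) i)
    ((Fin.cons X.root x : Fin (m + 1) → X.carrier) j)

/-- The symmetric matrix with zero diagonal and prescribed entries above the diagonal. -/
def ofPairs (m : ℕ) (d : Pairs m → ℝ≥0) : Fin (m + 1) → Fin (m + 1) → ℝ≥0 :=
  fun i j => if h : i < j then d ⟨(i, j), h⟩ else if h : j < i then d ⟨(j, i), h⟩ else 0

theorem continuous_ofPairs (m : ℕ) : Continuous (ofPairs m) := by
  refine continuous_pi fun i => continuous_pi fun j => ?_
  unfold ofPairs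
  split_ifs
  · exact continuous_apply _
  · exact continuous_apply _
  · exact continuous_const

theorem ofPairs_dists (X : MMSpace) (m : ℕ) (x : Fin m → X.carrier) :
    ofPairs m (X.dists m x) = X.distMatrix m x := by
  funext i j
  unfold ofPairs dists distMatrix
  split_ifs with h1 h2
  · rfl
  · exact nndist_comm _ _
  · rw [le_antisymm (not_lt.1 h2) (not_lt.1 h1), nndist_self]

theorem lintegral_distMat (X : MMSpace) (m : ℕ) {f : (Pairs m → ℝ≥0) → ℝ≥0∞}
    (hf : Measurable f) :
    ∫⁻ d, f d ∂(X.distMat m) = ∫⁻ x, f (X.dists m x) ∂(Measure.pi fun _ : Fin m => X.μ) :=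
  lintegral_map hf (X.measurable_dists m)

theorem continuous_distMatrix (X : MMSpace) (m : ℕ) : Continuous (X.distMatrix m) := by
  have h : ∀ i : Fin (m + 1),
      Continuous fun x : Fin m → X.carrier => (Fin.cons X.root x : Fin (m + 1) → X.carrier) i := by
    intro i
    refine Fin.cases ?_ (fun j => ?_) i
    · simpa using continuous_const
    · simpa using continuous_apply j
  exact continuous_pi fun i => continuous_pi fun j => (h i).nndist (h j)

theorem GromovWeak.tendsto_lintegral {X : ℕ → MMSpace} {Y : MMSpace} (h : GromovWeak X Y) (m : ℕ)
    {f : (Fin (m + 1) → Fin (m + 1) → ℝ≥0) → ℝ≥0} (hf : Continuous f) {C : ℝ≥0}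
    (hC : ∀ d, f d ≤ C) :
    Tendsto (fun n => ∫⁻ x, f ((X n).distMatrix m x) ∂(Measure.pi fun _ : Fin m => (X n).μ)) atTop
      (𝓝 (∫⁻ x, f (Y.distMatrix m x) ∂(Measure.pi fun _ : Fin m => Y.μ))) := by
  have hc : Continuous fun d : Pairs m → ℝ≥0 => f (ofPairs m d) := hf.comp (continuous_ofPairs m)
  have hb : ∀ d e : Pairs m → ℝ≥0, dist (f (ofPairs m d)) (f (ofPairs m e)) ≤ C := by
    intro d e
    rw [NNReal.dist_eq, abs_le]
    have h1 : ((f (ofPairs m d) : ℝ≥0) : ℝ) ≤ C := hC _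
    have h2 : ((f (ofPairs m e) : ℝ≥0) : ℝ) ≤ C := hC _
    have h3 := (f (ofPairs m d)).coe_nonneg
    have h4 := (f (ofPairs m e)).coe_nonneg
    constructor <;> linarith
  let g : (Pairs m → ℝ≥0) →ᵇ ℝ≥0 := ⟨⟨_, hc⟩, C, hb⟩
  have := h m g
  have key : ∀ Z : MMSpace, ∫⁻ d, (g d : ℝ≥0∞) ∂(Z.distMat m) =
      ∫⁻ x, f (Z.distMatrix m x) ∂(Measure.pi fun _ : Fin m => Z.μ) := by
    intro Z
    rw [Z.lintegral_distMat m g.continuous.measurable.coe_nnreal_ennreal]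
    refine lintegral_congr fun x => ?_
    rw [← ofPairs_dists]
    rfl
  simpa only [key] using this

theorem GromovWeak.tendsto_mass {X : ℕ → MMSpace} {Y : MMSpace} (h : GromovWeak X Y) :
    Tendsto (fun n => (X n).mass) atTop (𝓝 Y.mass) := by
  have := h.tendsto_lintegral 1 (f := fun _ => 1) continuous_const (C := 1) fun _ => le_rfl
  simpa [mass, Measure.pi_univ] using this

/-! ### Radial weights -/

/-- The space with the measure multiplied by a continuous function of the distance to the root. -/
noncomputable def weight (w : C(ℝ≥0, ℝ≥0)) (X : MMSpace) : MMSpace where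
  carrier := X.carrier
  root := X.root
  μ := X.μ.withDensity fun x => (w (nndist X.root x) : ℝ≥0∞)
  boundedlyFinite := fun s hs => by
    obtain ⟨r, hr⟩ := hs.subset_closedBall X.root
    obtain ⟨C, hC⟩ := (isCompact_Icc (a := (0 : ℝ≥0)) (b := r.toNNReal)).bddAbove_image
      w.continuous.continuousOn
    refine (measure_mono hr).trans_lt ?_
    rw [withDensity_apply _ Metric.isClosed_closedBall.measurableSet]
    calc ∫⁻ x in Metric.closedBall X.root r, (w (nndist X.root x) : ℝ≥0∞) ∂X.μ
        ≤ ∫⁻ _ in Metric.closedBall X.root r, (C : ℝ≥0∞) ∂X.μ := by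
          refine setLIntegral_mono measurable_const fun x hx => ?_
          refine ENNReal.coe_le_coe.2 (hC ⟨_, ⟨zero_le, ?_⟩, rfl⟩)
          rw [← NNReal.coe_le_coe, coe_nndist, dist_comm]
          exact (Metric.mem_closedBall.1 hx).trans (Real.le_coe_toNNReal r)
      _ < ∞ := by
          rw [lintegral_const, Measure.restrict_apply_univ]
          exact ENNReal.mul_lt_top ENNReal.coe_lt_top
            (X.boundedlyFinite _ Metric.isBounded_closedBall)

theorem measurable_radial (X : MMSpace) (w : C(ℝ≥0, ℝ≥0)) :
    Measurable fun x : X.carrier => w (nndist X.root x) :=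
  (w.continuous.comp (continuous_const.nndist continuous_id)).measurable

theorem ext_measure {X : MMSpace} {μ ν : Measure X.carrier}
    {hμ : ∀ s : Set X.carrier, Bornology.IsBounded s → μ s < ∞}
    {hν : ∀ s : Set X.carrier, Bornology.IsBounded s → ν s < ∞} (h : μ = ν) :
    ({ carrier := X.carrier, root := X.root, μ := μ, boundedlyFinite := hμ } : MMSpace) =
      { carrier := X.carrier, root := X.root, μ := ν, boundedlyFinite := hν } := by
  subst h; rfl

theorem weight_weight (X : MMSpace) (v w : C(ℝ≥0, ℝ≥0)) :
    (X.weight v).weight w = X.weight (v * w) := by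
  refine ext_measure (X := X) ?_
  change (X.μ.withDensity fun x => (v (nndist X.root x) : ℝ≥0∞)).withDensity
    (fun x => (w (nndist X.root x) : ℝ≥0∞)) = _
  rw [← withDensity_mul _ (X.measurable_radial v).coe_nnreal_ennreal
    (X.measurable_radial w).coe_nnreal_ennreal]
  rfl

theorem restr_weight (X : MMSpace) {R : ℝ} {w : C(ℝ≥0, ℝ≥0)} (hw : ∀ t : ℝ≥0, R < t → w t = 0) :
    (X.restr R).weight w = X.weight w := by
  refine ext_measure (X := X) ?_
  have hm : MeasurableSet (Metric.closedBall X.root R) := Metric.isClosed_closedBall.measurableSet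
  change (X.μ.restrict (Metric.closedBall X.root R)).withDensity
    (fun x : X.carrier => (w (nndist X.root x) : ℝ≥0∞)) = _
  rw [← withDensity_indicator hm]
  congr 1
  funext x
  by_cases hx : x ∈ Metric.closedBall X.root R
  · rw [indicator_of_mem hx]
  · rw [indicator_of_notMem hx, hw, ENNReal.coe_zero]
    rw [coe_nndist, dist_comm]
    simpa using hx

theorem weight_restr (X : MMSpace) {R : ℝ} {w : C(ℝ≥0, ℝ≥0)}
    (hw : ∀ t : ℝ≥0, (t : ℝ) ≤ R → w t = 1) : (X.weight w).restr R = X.restr R := by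
  refine ext_measure (X := X) ?_
  have hm : MeasurableSet (Metric.closedBall X.root R) := Metric.isClosed_closedBall.measurableSet
  change (X.μ.withDensity fun x => (w (nndist X.root x) : ℝ≥0∞)).restrict
    (Metric.closedBall X.root R) = _
  rw [restrict_withDensity hm]
  refine (withDensity_congr_ae ?_).trans withDensity_one
  filter_upwards [ae_restrict_mem hm] with x hx
  rw [hw _ (by rwa [coe_nndist, dist_comm])]
  rfl

theorem mass_weight (X : MMSpace) (w : C(ℝ≥0, ℝ≥0)) :
    (X.weight w).mass = ∫⁻ x, (w (nndist X.root x) : ℝ≥0∞) ∂X.μ := by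
  refine (withDensity_apply (μ := X.μ) _ MeasurableSet.univ).trans ?_
  rw [Measure.restrict_univ]

theorem mass_weight_lt_top_of_support (X : MMSpace) {R : ℝ} {w : C(ℝ≥0, ℝ≥0)}
    (hw : ∀ t : ℝ≥0, R < t → w t = 0) : (X.weight w).mass < ∞ := by
  have hm : MeasurableSet (Metric.closedBall X.root R) := Metric.isClosed_closedBall.measurableSet
  rw [mass_weight, ← setLIntegral_eq_of_support_subset (s := Metric.closedBall X.root R)]
  · rw [← withDensity_apply _ hm]
    exact (X.weight w).boundedlyFinite _ Metric.isBounded_closedBall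
  · intro x hx
    by_contra hcon
    refine hx ?_
    change ((w (nndist X.root x) : ℝ≥0) : ℝ≥0∞) = 0
    rw [hw, ENNReal.coe_zero]
    rw [coe_nndist, dist_comm]
    simpa using hcon

theorem lintegral_pi_weight (X : MMSpace) (w : C(ℝ≥0, ℝ≥0)) (m : ℕ)
    {g : (Fin m → X.carrier) → ℝ≥0∞} (hg : Measurable g) :
    ∫⁻ x, g x ∂(Measure.pi fun _ : Fin m => (X.weight w).μ) =
      ∫⁻ x, (∏ i, (w (nndist X.root (x i)) : ℝ≥0∞)) * g x ∂(Measure.pi fun _ : Fin m => X.μ) := by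
  have : (Measure.pi fun _ : Fin m => (X.weight w).μ) = _ :=
    pi_withDensity_fin (m := m) X.μ (X.measurable_radial w)
  rw [this]
  refine lintegral_withDensity_eq_lintegral_mul _ ?_ hg
  exact Finset.measurable_prod _ fun i _ =>
    ((X.measurable_radial w).comp (measurable_pi_apply i)).coe_nnreal_ennreal

/-- Bounded radial weights preserve Gromov-weak convergence: they multiply the distance matrix
distributions by a bounded continuous function of the distances. -/
theorem GromovWeak.weight {X : ℕ → MMSpace} {Y : MMSpace} (h : GromovWeak X Y)
    {w : C(ℝ≥0, ℝ≥0)} {C : ℝ≥0} (hC : ∀ t, w t ≤ C) :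
    GromovWeak (fun n => (X n).weight w) (Y.weight w) := by
  intro m f
  let F : (Fin (m + 1) → Fin (m + 1) → ℝ≥0) → ℝ≥0 := fun d =>
    (∏ i : Fin m, w (d 0 i.succ)) * f fun p => d p.1.1 p.1.2
  have hF : Continuous F := by
    refine Continuous.mul (continuous_finsetProd _ fun i _ => ?_) (f.continuous.comp ?_)
    · exact w.continuous.comp ((continuous_apply _).comp (continuous_apply _))
    · exact continuous_pi fun p => (continuous_apply _).comp (continuous_apply _)
  have hFC : ∀ d, F d ≤ C ^ m * nndist f 0 := by
    intro d
    refine mul_le_mul' ?_ ?_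
    · refine (Finset.prod_le_pow_card _ _ C fun i _ => hC _).trans ?_
      simp
    · rw [← NNReal.coe_le_coe]
      have := f.dist_coe_le_dist (g := 0) (x := fun p => d p.1.1 p.1.2)
      simpa [NNReal.dist_eq] using this
  have := h.tendsto_lintegral m hF hFC
  have key : ∀ Z : MMSpace, ∫⁻ d, f d ∂((Z.weight w).distMat m) =
      ∫⁻ x, F (Z.distMatrix m x) ∂(Measure.pi fun _ : Fin m => Z.μ) := by
    intro Z
    have hf : Measurable fun d => (f d : ℝ≥0∞) := f.continuous.measurable.coe_nnreal_ennreal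
    rw [lintegral_distMat _ _ hf]
    refine (Z.lintegral_pi_weight w m (hf.comp (Z.measurable_dists m))).trans ?_
    refine lintegral_congr fun x => ?_
    simp only [F, ENNReal.coe_mul, ENNReal.ofNNReal_finsetProd, distMatrix, Fin.cons_zero,
      Fin.cons_succ]
    rfl
  simpa only [key] using this

/-- The continuous cutoff that is `1` on `[0, k]`, `0` on `[k + 1, ∞)` and linear in between. -/
noncomputable def cutoff (k : ℕ) : C(ℝ≥0, ℝ≥0) :=
  ⟨fun t => min 1 (k + 1 - t), continuous_const.min (continuous_const.sub continuous_id)⟩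

theorem cutoff_le_one (k : ℕ) (t : ℝ≥0) : cutoff k t ≤ 1 := min_le_left _ _

theorem cutoff_eq_one {k : ℕ} {t : ℝ≥0} (h : (t : ℝ) ≤ k) : cutoff k t = 1 := by
  refine min_eq_left ?_
  have h' : t ≤ k := by exact_mod_cast h
  exact le_tsub_of_add_le_left (add_le_add_left h' 1)

theorem cutoff_eq_zero {k : ℕ} {t : ℝ≥0} (h : (k : ℝ) + 1 ≤ t) : cutoff k t = 0 := by
  have h' : (k : ℝ≥0) + 1 ≤ t := by exact_mod_cast h
  change min 1 ((k : ℝ≥0) + 1 - t) = 0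
  rw [tsub_eq_zero_of_le h']
  simp

theorem mass_weight_cutoff_lt_top (X : MMSpace) (k : ℕ) : (X.weight (cutoff k)).mass < ∞ :=
  X.mass_weight_lt_top_of_support (R := (k : ℝ) + 1) fun _ ht => cutoff_eq_zero ht.le

end MMSpace

/-! ### The Gromov-vague topology through continuous cutoffs -/

/-- A topology whose open sets are those that eventually capture every sequence `u` with
`f ∘ u → f a`, `a` in the set, is induced by `f` if the target of `f` is first countable. -/
theorem isInducing_of_isOpen_iff_seq {α β : Type*} [TopologicalSpace α] [TopologicalSpace β]
    [FirstCountableTopology β] (f : α → β) {C : (ℕ → α) → α → Prop}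
    (hC : ∀ u a, C u a ↔ Tendsto (fun n => f (u n)) atTop (𝓝 (f a)))
    (hopen : ∀ U : Set α, IsOpen U ↔ ∀ u a, a ∈ U → C u a → ∀ᶠ n in atTop, u n ∈ U) :
    IsInducing f := by
  refine (isInducing_iff _).2 (TopologicalSpace.ext_iff.2 fun U => ?_)
  rw [hopen, isOpen_induced_iff]
  constructor
  · intro hU
    have hV : ∀ a ∈ U, ∃ V ∈ 𝓝 (f a), f ⁻¹' V ⊆ U := by
      intro a ha
      by_contra! hcon
      obtain ⟨V, hV⟩ := (𝓝 (f a)).exists_antitone_basis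
      have : ∀ n, ∃ b, f b ∈ V n ∧ b ∉ U := fun n => by
        obtain ⟨b, hb, hbU⟩ := not_subset.1 (hcon (V n) (hV.1.mem_of_mem trivial))
        exact ⟨b, hb, hbU⟩
      choose u huV huU using this
      obtain ⟨n, hn⟩ := (hU u a ha ((hC u a).2 (hV.tendsto huV))).exists
      exact huU n hn
    choose! V hV hVU using hV
    refine ⟨⋃ a ∈ U, interior (V a), isOpen_biUnion fun _ _ => isOpen_interior,
      Subset.antisymm ?_ fun a ha => mem_biUnion ha (mem_interior_iff_mem_nhds.2 (hV a ha))⟩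
    intro b hb
    simp only [mem_preimage, mem_iUnion] at hb
    obtain ⟨a, ha, hba⟩ := hb
    exact hVU a ha (mem_preimage.2 (interior_subset hba))
  · rintro ⟨V, hV, rfl⟩ u a ha hu
    exact (hC u a).1 hu (hV.mem_nhds ha)

namespace MMSpace

open scoped BoundedContinuousFunction

/-- The matrices all of whose distances from the root are at most `R`. -/
def rootBox (m : ℕ) (R : ℝ) : Set (Pairs m → ℝ≥0) :=
  {d | ∀ i : Fin m, (d ⟨(0, i.succ), i.succ_pos⟩ : ℝ) ≤ R}

theorem isClosed_rootBox (m : ℕ) (R : ℝ) : IsClosed (rootBox m R) := by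
  simp only [rootBox, ofPred_forall]
  exact isClosed_iInter fun i =>
    isClosed_le (NNReal.continuous_coe.comp (continuous_apply _)) continuous_const

theorem frontier_rootBox_subset (m : ℕ) (R : ℝ) :
    frontier (rootBox m R) ⊆ ⋃ i : Fin m, {d | (d ⟨(0, i.succ), i.succ_pos⟩ : ℝ) = R} := by
  intro d hd
  rw [(isClosed_rootBox m R).frontier_eq] at hd
  by_contra hcon
  simp only [mem_iUnion, mem_ofPred_eq, not_exists] at hcon
  refine hd.2 (mem_interior.2
    ⟨{d | ∀ i : Fin m, (d ⟨(0, i.succ), i.succ_pos⟩ : ℝ) < R}, fun e he i => (he i).le, ?_,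
      fun i => lt_of_le_of_ne (hd.1 i) (hcon i)⟩)
  simp only [ofPred_forall]
  exact isOpen_iInter_of_finite fun i =>
    isOpen_lt (NNReal.continuous_coe.comp (continuous_apply _)) continuous_const

theorem dists_zero_succ (X : MMSpace) (m : ℕ) (x : Fin m → X.carrier) (i : Fin m) :
    X.dists m x ⟨(0, i.succ), i.succ_pos⟩ = nndist X.root (x i) := by
  simp [dists]

/-- Restricting the measure to a ball restricts the distance matrix distributions to a box. -/
theorem distMat_restr (X : MMSpace) (m : ℕ) (R : ℝ) :
    (X.restr R).distMat m = (X.distMat m).restrict (rootBox m R) := by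
  rw [distMat, distMat, Measure.restrict_map (X.measurable_dists m)
    (isClosed_rootBox m R).measurableSet]
  have h : X.dists m ⁻¹' rootBox m R = univ.pi fun _ : Fin m => Metric.closedBall X.root R := by
    ext x
    simp only [rootBox, mem_preimage, mem_ofPred_eq, dists_zero_succ, Set.mem_pi, mem_univ,
      forall_true_left, Metric.mem_closedBall, coe_nndist, dist_comm]
  rw [h, Measure.restrict_pi_pi]
  rfl

/-- Restriction to a closed ball is continuous for Gromov-weak convergence when the limit does not
charge the bounding sphere. -/
theorem GromovWeak.restr {X : ℕ → MMSpace} {Y : MMSpace} (h : GromovWeak X Y)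
    (hX : ∀ n, (X n).mass < ∞) (hY : Y.mass < ∞) {R : ℝ}
    (hR : Y.μ {x | dist Y.root x = R} = 0) :
    GromovWeak (fun n => (X n).restr R) (Y.restr R) := by
  intro m f
  simp only [distMat_restr]
  have hm := (isClosed_rootBox m R).measurableSet
  refine tendsto_setLIntegral_of_null_frontier (h.tendsto_distMat hX hY m) hm ?_ f
  refine measure_mono_null (frontier_rootBox_subset m R) (measure_iUnion_null fun i => ?_)
  change Y.distMat m _ = 0
  have hmi : MeasurableSet {d : Pairs m → ℝ≥0 | (d ⟨(0, i.succ), i.succ_pos⟩ : ℝ) = R} :=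
    (measurable_coe_nnreal_real.comp (measurable_pi_apply (⟨(0, i.succ), i.succ_pos⟩ : Pairs m)))
      (measurableSet_singleton R)
  rw [distMat, Measure.map_apply (Y.measurable_dists m) hmi]
  have : Y.dists m ⁻¹' {d : Pairs m → ℝ≥0 | (d ⟨(0, i.succ), i.succ_pos⟩ : ℝ) = R} =
      Function.eval i ⁻¹' {x | dist Y.root x = R} := by
    ext x
    simp only [mem_preimage, mem_ofPred_eq, dists_zero_succ, coe_nndist, Function.eval]
  rw [this]
  exact Measure.pi_eval_preimage_null _ hR

theorem countable_charged_spheres (X : MMSpace) :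
    {R : ℝ | X.μ {x | dist X.root x = R} ≠ 0}.Countable := by
  have := Measure.countable_meas_level_set_pos (μ := X.μ)
    (g := fun x => dist X.root x) (continuous_const.dist continuous_id).measurable
  simpa only [pos_iff_ne_zero] using this

/-- Gromov-vague convergence is Gromov-weak convergence after multiplying the measures by each
cutoff. In one direction some radius beyond the support of the cutoff is not exceptional; in the
other, the only exceptional radii are those of the countably many spheres charged by the limit. -/
theorem gvConverges_iff {X : ℕ → MMSpace} {Y : MMSpace} :
    MM.GVConverges (fun n => (X n).toMM) Y.toMM ↔
      ∀ k, GromovWeak (fun n => (X n).weight (cutoff k)) (Y.weight (cutoff k)) := by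
  have hrestr : ∀ R : ℝ, Tendsto (fun n => MM.restr R (X n).toMM) atTop
      (𝓝 (MM.restr R Y.toMM)) ↔ GromovWeak (fun n => (X n).restr R) (Y.restr R) :=
    fun R => tendsto_toFin_iff (fun n => (X n).mass_restr_lt_top R) (Y.mass_restr_lt_top R)
  constructor
  · intro h k
    obtain ⟨R, hR, hRk⟩ : ∃ R : ℝ, (k : ℝ) + 1 < R ∧
        R ∉ {R : ℝ | 0 < R ∧ ¬ Tendsto (fun n => MM.restr R (X n).toMM) atTop
          (𝓝 (MM.restr R Y.toMM))} := by
      by_contra! hcon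
      have h1 : (Ioi ((k : ℝ) + 1)).Countable := h.mono fun R hR => hcon R hR
      have h2 := Cardinal.le_aleph0_iff_set_countable.2 h1
      rw [Cardinal.mk_Ioi_real] at h2
      exact absurd h2 (not_le.2 Cardinal.aleph0_lt_continuum)
    have hR0 : 0 < R := lt_trans (by positivity) hR
    have hw : GromovWeak (fun n => (X n).restr R) (Y.restr R) := by
      rw [← hrestr]
      by_contra hcon
      exact hRk ⟨hR0, hcon⟩
    have hz : ∀ t : ℝ≥0, R < t → cutoff k t = 0 := fun t ht => cutoff_eq_zero (hR.trans ht).le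
    have := hw.weight (w := cutoff k) (C := 1) (cutoff_le_one k)
    simpa only [restr_weight _ hz] using this
  · intro h
    refine (Y.countable_charged_spheres).mono fun R hR => ?_
    by_contra hch
    have hcon : Y.μ {x | dist Y.root x = R} = 0 := not_not.1 hch
    refine hR.2 ((hrestr R).2 ?_)
    obtain ⟨k, hk⟩ := exists_nat_ge R
    have h1 : ∀ t : ℝ≥0, (t : ℝ) ≤ R → cutoff k t = 1 := fun t ht => cutoff_eq_one (ht.trans hk)
    have hs : (Y.weight (cutoff k)).μ {x | dist (Y.weight (cutoff k)).root x = R} = 0 :=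
      (withDensity_absolutelyContinuous _ _) hcon
    have := (h k).restr (fun n => (X n).mass_weight_cutoff_lt_top k)
      (Y.mass_weight_cutoff_lt_top k) hs
    simpa only [weight_restr _ h1] using this

theorem IsEmb.weight {X Y : MMSpace} {f : X.carrier → Y.carrier} (hf : IsEmb X Y f)
    (w : C(ℝ≥0, ℝ≥0)) : IsEmb (X.weight w) (Y.weight w) f := by
  refine ⟨hf.1, hf.2.1, Measure.ext fun (s : Set Y.carrier) (hs : MeasurableSet s) => ?_⟩
  change (Measure.map f (X.μ.withDensity fun x => (w (nndist X.root x) : ℝ≥0∞))) s =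
    (Y.μ.withDensity fun y => (w (nndist Y.root y) : ℝ≥0∞)) s
  rw [Measure.map_apply hf.measurable hs, withDensity_apply _ (hf.measurable hs),
    withDensity_apply _ hs]
  conv_rhs => rw [← hf.2.2]
  rw [setLIntegral_map hs (Y.measurable_radial w).coe_nnreal_ennreal hf.measurable]
  simp only [← hf.2.1, hf.1.nndist_eq]

end MMSpace

namespace MM

/-- The class with the measure multiplied by the cutoff at radius `k`. -/
noncomputable def cut (k : ℕ) (𝒳 : MM) : MMFin :=
  Quotient.lift
    (fun X : MMSpace => (X.weight (MMSpace.cutoff k)).toFin (X.mass_weight_cutoff_lt_top k))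
    (fun _ _ h => MMSpace.Equivalent.invariant
      (fun X : MMSpace => (X.weight (MMSpace.cutoff k)).toFin (X.mass_weight_cutoff_lt_top k))
      (fun _ _ _ hf => MMFin.mk.injEq .. ▸ Quotient.sound (hf.weight _).equivalent) h) 𝒳

theorem gvConverges_iff_tendsto_cut {u : ℕ → MM} {𝒳 : MM} :
    GVConverges u 𝒳 ↔
      Tendsto (fun n k => cut k (u n)) atTop (𝓝 fun k => cut k 𝒳) := by
  obtain ⟨Y, rfl⟩ : ∃ Y : MMSpace, Y.toMM = 𝒳 := Quotient.exists_rep 𝒳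
  choose X hX using fun n => (Quotient.exists_rep (u n) : ∃ Y : MMSpace, Y.toMM = u n)
  obtain rfl : (fun n => (X n).toMM) = u := funext hX
  rw [MMSpace.gvConverges_iff, tendsto_pi_nhds]
  exact forall_congr' fun k => (MMSpace.tendsto_toFin_iff
    (fun n => (X n).mass_weight_cutoff_lt_top k) (Y.mass_weight_cutoff_lt_top k)).symm

/-- The Gromov-vague topology is induced by the cutoffs. -/
theorem isInducing_cut : IsInducing fun (𝒳 : MM) (k : ℕ) => cut k 𝒳 := by
  have := pseudoMetrizableSpace_pi_countable (E := fun _ : ℕ => MMFin)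
  exact isInducing_of_isOpen_iff_seq _ (fun _ _ => gvConverges_iff_tendsto_cut) fun _ => Iff.rfl

instance : TopologicalSpace.PseudoMetrizableSpace MM := by
  have := pseudoMetrizableSpace_pi_countable (E := fun _ : ℕ => MMFin)
  exact isInducing_cut.pseudoMetrizableSpace

/-- Convergence in the Gromov-vague topology, read off from representatives. -/
theorem tendsto_mk_iff {X : ℕ → MMSpace} {Y : MMSpace} :
    Tendsto (fun n => (X n).toMM) atTop (𝓝 Y.toMM) ↔
      ∀ k, MMSpace.GromovWeak (fun n => (X n).weight (MMSpace.cutoff k))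
        (Y.weight (MMSpace.cutoff k)) := by
  rw [isInducing_cut.tendsto_nhds_iff, ← MMSpace.gvConverges_iff, gvConverges_iff_tendsto_cut]
  rfl

end MM

/-! ### Limits along almost isometries -/

namespace MMSpace

theorem pi_eval_preimage_real_le {Ω : Type*} [MeasurableSpace Ω] (μ : Measure Ω)
    [IsFiniteMeasure μ] {M ε : ℝ} (hM : μ.real univ ≤ M) {s : Set Ω} (hs : MeasurableSet s)
    (hε : μ.real s ≤ ε) (m : ℕ) (i : Fin m) :
    (Measure.pi fun _ : Fin m => μ).real (Function.eval i ⁻¹' s) ≤ M ^ (m - 1) * ε := by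
  have h : (Measure.pi fun _ : Fin m => μ).real (Function.eval i ⁻¹' s) =
      ((∏ _j ∈ Finset.univ.erase i, μ univ) • μ).real s := by
    rw [← Measure.pi_map_eval (fun _ : Fin m => μ) i]
    exact (map_measureReal_apply (measurable_pi_apply (X := fun _ : Fin m => Ω) i) hs).symm
  rw [h, measureReal_ennreal_smul_apply]
  simp only [Finset.prod_const, Finset.card_erase_of_mem (Finset.mem_univ i), Finset.card_univ,
    Fintype.card_fin, ENNReal.toReal_pow]
  have : (0 : ℝ) ≤ M := measureReal_nonneg.trans hM
  exact mul_le_mul (pow_le_pow_left₀ ENNReal.toReal_nonneg hM _) hε measureReal_nonneg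
    (pow_nonneg this _)

theorem dist_dists_le {X Y : MMSpace} {T : X.carrier → Y.carrier} {G : Set X.carrier} {ε : ℝ}
    (hε : 0 ≤ ε) (hdist : ∀ x ∈ G, ∀ y ∈ G, |dist x y - dist (T x) (T y)| ≤ ε)
    (hroot : ∀ x ∈ G, |dist X.root x - dist Y.root (T x)| ≤ ε) {m : ℕ} {x : Fin m → X.carrier}
    (hx : ∀ i, x i ∈ G) : dist (X.dists m x) (Y.dists m (T ∘ x)) ≤ ε := by
  refine (dist_pi_le_iff hε).2 ?_
  rintro ⟨⟨i, j⟩, hij⟩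
  rw [NNReal.dist_eq]
  simp only [dists, coe_nndist]
  revert hij
  refine Fin.cases (fun h => absurd h (Fin.not_lt_zero i)) (fun j hij => ?_) j
  refine Fin.cases ?_ (fun i => ?_) i
  · simpa using hroot _ (hx j)
  · simpa using hdist _ (hx i) _ (hx j)

/-- If maps into a fixed space distort distances by little off sets of small measure, and push the
measures forward to a weakly convergent sequence, then the spaces converge Gromov-weakly. -/
theorem gromovWeak_of_almost_isometries {X : ℕ → MMSpace} {Y : MMSpace}
    (T : ∀ n, (X n).carrier → Y.carrier) (hT : ∀ n, Measurable (T n)) {M : ℕ}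
    (hM : ∀ n, (X n).mass ≤ M) {ε : ℕ → ℝ} (hε0 : ∀ n, 0 ≤ ε n) (hε : Tendsto ε atTop (𝓝 0))
    (G : ∀ n, Set (X n).carrier) (hGm : ∀ n, MeasurableSet (G n))
    (hG : ∀ n, (X n).μ (G n)ᶜ ≤ ENNReal.ofReal (ε n))
    (hdist : ∀ n, ∀ x ∈ G n, ∀ y ∈ G n, |dist x y - dist (T n x) (T n y)| ≤ ε n)
    (hroot : ∀ n, ∀ x ∈ G n, |dist (X n).root x - dist Y.root (T n x)| ≤ ε n)
    {ν : ℕ → FiniteMeasure Y.carrier} {κ : FiniteMeasure Y.carrier}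
    (hν : ∀ n, (ν n : Measure Y.carrier) = (X n).μ.map (T n)) (hκ : (κ : Measure Y.carrier) = Y.μ)
    (hlim : Tendsto ν atTop (𝓝 κ)) : GromovWeak X Y := by
  have hXfin : ∀ n, (X n).mass < ∞ := fun n => (hM n).trans_lt (by simp)
  have hfin : ∀ n, IsFiniteMeasure (X n).μ := fun n => ⟨hXfin n⟩
  have hYfin : Y.mass < ∞ := by
    rw [mass, ← hκ]; exact measure_lt_top _ _
  have hYf : IsFiniteMeasure Y.μ := ⟨hYfin⟩
  have : Nonempty Y.carrier := ⟨Y.root⟩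
  rw [← tendsto_toFin_iff hXfin hYfin, MMFin.isInducing_distMat.tendsto_nhds_iff, tendsto_pi_nhds]
  intro m
  refine tendsto_finiteMeasure_of_forall_lipschitz ?_
  rintro f ⟨C, hC⟩ ⟨L, hL⟩
  have hC0 : 0 ≤ C := (abs_nonneg _).trans (hC 0)
  have hfm := hL.continuous.measurable
  have hI : ∀ Z : MMSpace, ∫ d, f d ∂(Z.distMat m) =
      ∫ x, f (Z.dists m x) ∂(Measure.pi fun _ : Fin m => Z.μ) := fun Z =>
    integral_map (Z.measurable_dists m).aemeasurable hfm.aestronglyMeasurable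
  change Tendsto (fun n => ∫ d, f d ∂((X n).distMat m)) atTop (𝓝 (∫ d, f d ∂(Y.distMat m)))
  simp only [hI]
  -- the integrals over the images converge, by continuity of products of measures
  have hb : Tendsto (fun n => ∫ x, f (Y.dists m (T n ∘ x)) ∂(Measure.pi fun _ : Fin m => (X n).μ))
      atTop (𝓝 (∫ y, f (Y.dists m y) ∂(Measure.pi fun _ : Fin m => Y.μ))) := by
    have h1 := tendsto_finiteMeasure_pi hlim m
    have hcd : Continuous (Y.dists m) := by
      refine continuous_pi fun p => ?_
      exact (continuous_apply p.1.2).comp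
        ((continuous_apply p.1.1).comp (Y.continuous_distMatrix m))
    let g : BoundedContinuousFunction (Fin m → Y.carrier) ℝ :=
      BoundedContinuousFunction.ofNormedAddCommGroup (fun y => f (Y.dists m y))
        (hL.continuous.comp hcd) C fun y => hC _
    have h2 := FiniteMeasure.tendsto_iff_forall_integral_tendsto.1 h1 g
    have hTm : ∀ n, Measurable fun (x : Fin m → (X n).carrier) i => T n (x i) := fun n =>
      measurable_pi_lambda _ fun i => (hT n).comp (measurable_pi_apply i)
    have hgm : Measurable fun y => f (Y.dists m y) := hfm.comp (Y.measurable_dists m)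
    have h3 : ∀ n, ∫ y, g y ∂(FiniteMeasure.pi (fun _ : Fin m => ν n) : Measure _) =
        ∫ x, f (Y.dists m (T n ∘ x)) ∂(Measure.pi fun _ : Fin m => (X n).μ) := by
      intro n
      have h4 : (FiniteMeasure.pi (fun _ : Fin m => ν n) : Measure (Fin m → Y.carrier)) =
          (Measure.pi fun _ : Fin m => (X n).μ).map fun x i => T n (x i) := by
        have hsf : SigmaFinite ((X n).μ.map (T n)) := by rw [← hν n]; infer_instance
        rw [FiniteMeasure.toMeasure_pi, Measure.pi_map_pi fun _ => (hT n).aemeasurable]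
        simp only [hν]
      rw [h4]
      exact integral_map (hTm n).aemeasurable hgm.aestronglyMeasurable
    have h5 : ∫ y, g y ∂(FiniteMeasure.pi (fun _ : Fin m => κ) : Measure _) =
        ∫ y, f (Y.dists m y) ∂(Measure.pi fun _ : Fin m => Y.μ) := by
      rw [FiniteMeasure.toMeasure_pi]
      simp only [hκ]
      rfl
    simp only [h3] at h2
    rw [← h5]
    exact h2
  -- the two integrals differ by little
  set c : ℝ := L * (M : ℝ) ^ m + 2 * C * (m * (M : ℝ) ^ (m - 1)) with hc
  have hdiff : ∀ n, |∫ x, f ((X n).dists m x) ∂(Measure.pi fun _ : Fin m => (X n).μ) -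
      ∫ x, f (Y.dists m (T n ∘ x)) ∂(Measure.pi fun _ : Fin m => (X n).μ)| ≤ c * ε n := by
    intro n
    have hTm : Measurable fun (x : Fin m → (X n).carrier) => T n ∘ x :=
      measurable_pi_lambda _ fun i => (hT n).comp (measurable_pi_apply i)
    set P := Measure.pi fun _ : Fin m => (X n).μ
    have hi1 : Integrable (fun x => f ((X n).dists m x)) P :=
      Integrable.of_bound (hfm.comp ((X n).measurable_dists m)).aestronglyMeasurable C
        (Eventually.of_forall fun x => hC _)
    have hi2 : Integrable (fun x => f (Y.dists m (T n ∘ x))) P :=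
      Integrable.of_bound (hfm.comp ((Y.measurable_dists m).comp hTm)).aestronglyMeasurable C
        (Eventually.of_forall fun x => hC _)
    rw [← integral_sub hi1 hi2]
    set B : Set (Fin m → (X n).carrier) := ⋃ i, Function.eval i ⁻¹' (G n)ᶜ with hB
    have hBm : MeasurableSet B :=
      MeasurableSet.iUnion fun i => measurable_pi_apply i (hGm n).compl
    have hMr : (X n).μ.real univ ≤ M := by
      have := ENNReal.toReal_mono (by simp) (hM n)
      simpa only [mass, ENNReal.toReal_natCast, Measure.real] using this
    have hGr : (X n).μ.real (G n)ᶜ ≤ ε n := by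
      have := ENNReal.toReal_mono (by simp) (hG n)
      rwa [ENNReal.toReal_ofReal (hε0 n)] at this
    have hPu : P.real univ ≤ (M : ℝ) ^ m := by
      have : P.real univ = ((X n).μ.real univ) ^ m := by
        simp [P, Measure.real, Measure.pi_univ]
      rw [this]
      exact pow_le_pow_left₀ measureReal_nonneg hMr m
    have hPB : P.real B ≤ m * ((M : ℝ) ^ (m - 1) * ε n) := by
      refine (measureReal_iUnion_fintype_le _).trans ?_
      refine (Finset.sum_le_sum fun i _ =>
        pi_eval_preimage_real_le (X n).μ hMr (hGm n).compl hGr m i).trans ?_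
      simp
    have hpt : ∀ x, ‖f ((X n).dists m x) - f (Y.dists m (T n ∘ x))‖ ≤
        L * ε n + B.indicator (fun _ => 2 * C) x := by
      intro x
      by_cases hx : x ∈ B
      · rw [indicator_of_mem hx, Real.norm_eq_abs]
        have h1 := abs_sub (f ((X n).dists m x)) (f (Y.dists m (T n ∘ x)))
        have h2 := hC ((X n).dists m x)
        have h3 := hC (Y.dists m (T n ∘ x))
        have h4 : 0 ≤ (L : ℝ) * ε n := mul_nonneg L.coe_nonneg (hε0 n)
        linarith
      · rw [indicator_of_notMem hx, add_zero]
        have hx' : ∀ i, x i ∈ G n := by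
          intro i
          by_contra hcon
          exact hx (mem_iUnion.2 ⟨i, hcon⟩)
        rw [← dist_eq_norm]
        refine (hL.dist_le_mul _ _).trans ?_
        exact mul_le_mul_of_nonneg_left
          (dist_dists_le (hε0 n) (hdist n) (hroot n) hx') L.coe_nonneg
    calc |∫ x, (f ((X n).dists m x) - f (Y.dists m (T n ∘ x))) ∂P|
        ≤ ∫ x, (L * ε n + B.indicator (fun _ => 2 * C) x) ∂P := by
          rw [← Real.norm_eq_abs]
          refine norm_integral_le_of_norm_le ?_ (Eventually.of_forall hpt)
          exact (integrable_const _).add ((integrable_const _).indicator hBm)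
      _ = P.real univ * (L * ε n) + P.real B * (2 * C) := by
          rw [integral_add (integrable_const _) ((integrable_const _).indicator hBm),
            integral_indicator_const _ hBm, integral_const]
          simp
      _ ≤ (M : ℝ) ^ m * (L * ε n) + m * ((M : ℝ) ^ (m - 1) * ε n) * (2 * C) := by
          have h4 : 0 ≤ (L : ℝ) * ε n := mul_nonneg L.coe_nonneg (hε0 n)
          gcongr
      _ = c * ε n := by rw [hc]; ring
  have h0 : Tendsto (fun n => c * ε n) atTop (𝓝 0) := by simpa using hε.const_mul c
  have := (squeeze_zero_norm hdiff h0).add hb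
  simpa using this

/-! ### Sufficiency: uniform approximation gives subsequential limits -/

/-- Quantitative approximation by finitely many points: the total mass is at most `N`, and all but
mass `ε` lies within `ε` of `N` points at distance at most `N` from the root. The points are the
first `N` terms of a sequence, which makes the condition monotone in `N`. -/
def IsApprox (X : MMSpace) (N : ℕ) (ε : ℝ) : Prop :=
  X.mass ≤ N ∧ ∃ p : ℕ → X.carrier, (∀ i, dist X.root (p i) ≤ N) ∧
    X.μ {x | ∀ i < N, ε < dist x (p i)} ≤ ENNReal.ofReal ε

theorem IsApprox.mono {X : MMSpace} {N N' : ℕ} {ε ε' : ℝ} (h : X.IsApprox N ε) (hN : N ≤ N')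
    (hε : ε ≤ ε') : X.IsApprox N' ε' := by
  obtain ⟨h1, p, h2, h3⟩ := h
  refine ⟨h1.trans (by exact_mod_cast hN), p, fun i => (h2 i).trans (by exact_mod_cast hN), ?_⟩
  refine (measure_mono fun x hx i hi => ?_).trans (h3.trans (ENNReal.ofReal_le_ofReal hε))
  exact hε.trans_lt (hx i (hi.trans_le hN))

end MMSpace

/-- A pseudo-metric on a countable type is realised by points of a complete separable metric
space. -/
theorem exists_polish_of_pseudoMetric {ι : Type} [Countable ι] (D : ι → ι → ℝ)
    (hself : ∀ a, D a a = 0) (hcomm : ∀ a b, D a b = D b a)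
    (htri : ∀ a b c, D a c ≤ D a b + D b c) :
    ∃ (Y : Type) (_ : MetricSpace Y) (_ : CompleteSpace Y)
      (_ : TopologicalSpace.SeparableSpace Y) (q : ι → Y), ∀ a b, dist (q a) (q b) = D a b := by
  let _ : PseudoMetricSpace ι :=
    { dist := D, dist_self := hself, dist_comm := hcomm, dist_triangle := htri }
  have : TopologicalSpace.SeparableSpace ι := ⟨univ, countable_univ, dense_univ⟩
  exact ⟨UniformSpace.Completion ι, inferInstance, inferInstance, inferInstance, fun a => a,
    fun a b => UniformSpace.Completion.dist_eq a b⟩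

theorem exists_subseq_tendsto_dist (X : ℕ → MMSpace) {ι : Type} [Countable ι]
    (P : ∀ n, ι → (X n).carrier) (C : ι → ι → ℝ) (hC : ∀ n a b, dist (P n a) (P n b) ≤ C a b) :
    ∃ (φ : ℕ → ℕ) (D : ι → ι → ℝ), StrictMono φ ∧
      ∀ a b, Tendsto (fun n => dist (P (φ n) a) (P (φ n) b)) atTop (𝓝 (D a b)) := by
  have hcomp : IsCompact (univ.pi fun a => univ.pi fun b => Icc 0 (C a b)) :=
    isCompact_univ_pi fun a => isCompact_univ_pi fun b => isCompact_Icc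
  obtain ⟨D, -, φ, hφ, hD⟩ := hcomp.tendsto_subseq
    (x := fun n a b => dist (P n a) (P n b)) fun n a _ b _ => ⟨dist_nonneg, hC n a b⟩
  exact ⟨φ, D, hφ, fun a b => tendsto_pi_nhds.1 (tendsto_pi_nhds.1 hD a) b⟩

theorem isCompact_iInter_biUnion_closedBall {Y : Type*} [MetricSpace Y] [CompleteSpace Y]
    (A : ℕ → Finset Y) {r : ℕ → ℝ} (hr : Tendsto r atTop (𝓝 0)) (j : ℕ) :
    IsCompact (⋂ k, ⋃ y ∈ A (j + k), Metric.closedBall y (r (j + k))) := by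
  refine TotallyBounded.isCompact_of_isClosed ?_ ?_
  · refine Metric.totallyBounded_iff.2 fun δ hδ => ?_
    have h1 : Tendsto (fun k => r (j + k)) atTop (𝓝 0) :=
      hr.comp (tendsto_atTop_mono (fun k => Nat.le_add_left k j) tendsto_id)
    obtain ⟨k, hk⟩ := (h1.eventually_lt_const hδ).exists
    refine ⟨A (j + k), Finset.finite_toSet _, (iInter_subset _ k).trans ?_⟩
    exact iUnion₂_mono fun y _ => Metric.closedBall_subset_ball hk
  · exact isClosed_iInter fun k =>
      (Finset.finite_toSet _).isClosed_biUnion fun y _ => Metric.isClosed_closedBall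

/-- **Prokhorov's theorem** for measures concentrated near finite sets: if all but mass
`2 * 2⁻¹ ^ k` of each measure lies within `r k → 0` of a finite set depending only on `k`, and the
masses are bounded, then there is a weakly convergent subsequence. -/
theorem exists_subseq_tendsto_of_near_finite {Y : Type*} [MetricSpace Y] [CompleteSpace Y]
    [TopologicalSpace.SeparableSpace Y] [MeasurableSpace Y] [BorelSpace Y] [Nonempty Y]
    (A : ℕ → Finset Y) {r : ℕ → ℝ} (hr : Tendsto r atTop (𝓝 0)) (ν : ℕ → FiniteMeasure Y) (M : ℝ≥0)
    (hM : ∀ n, (ν n).mass ≤ M)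
    (hA : ∀ n k, (ν n : Measure Y) (⋃ y ∈ A k, Metric.closedBall y (r k))ᶜ ≤ 2 * 2⁻¹ ^ k) :
    ∃ (κ : FiniteMeasure Y) (φ : ℕ → ℕ), StrictMono φ ∧ Tendsto (ν ∘ φ) atTop (𝓝 κ) := by
  have := pseudoMetrizableSpace_finiteMeasure (Ω := Y)
  set u : ℕ → ℝ≥0 := fun j => 4 * 2⁻¹ ^ j with hu
  have hu0 : Tendsto u atTop (𝓝 0) := by
    have : Tendsto (fun j => (2⁻¹ : ℝ≥0) ^ j) atTop (𝓝 0) := by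
      refine NNReal.tendsto_pow_atTop_nhds_zero_of_lt_one ?_
      rw [← NNReal.coe_lt_coe]; norm_num
    simpa [hu] using this.const_mul 4
  have hcomp := isCompact_setOfPred_finiteMeasure_mass_le_compl_isCompact_le M hu0
    (fun j => isCompact_iInter_biUnion_closedBall A hr j) (Or.inl inferInstance)
  have hmem : ∀ n, ν n ∈ {μ : FiniteMeasure Y | μ.mass ≤ M ∧
      ∀ j, μ (⋂ k, ⋃ y ∈ A (j + k), Metric.closedBall y (r (j + k)))ᶜ ≤ u j} := by
    refine fun n => ⟨hM n, fun j => ?_⟩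
    rw [← ENNReal.coe_le_coe, FiniteMeasure.ennreal_coeFn_eq_coeFn_toMeasure, compl_iInter]
    refine (measure_iUnion_le _).trans ((ENNReal.tsum_le_tsum fun k => hA n (j + k)).trans ?_)
    rw [ENNReal.tsum_mul_left]
    simp only [pow_add]
    rw [ENNReal.tsum_mul_left, ENNReal.tsum_geometric, ENNReal.one_sub_inv_two, inv_inv, hu]
    push_cast
    rw [mul_comm _ (2 : ℝ≥0∞), ← mul_assoc]
    norm_num
  obtain ⟨κ, -, φ, hφ, hκ⟩ := hcomp.tendsto_subseq hmem
  exact ⟨κ, φ, hφ, hκ⟩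

namespace MMSpace

/-- Uniformly approximable spaces have a Gromov-weakly convergent subsequence. The distances
between the approximating points converge along a subsequence; the limit space is the completion of
the limiting pseudo-metric on the index set of these points, and the limit measure is a weak limit
of the images of the measures under nearest point maps. -/
theorem exists_subseq_gromovWeak (X : ℕ → MMSpace)
    (h : ∀ ε : ℝ, 0 < ε → ∃ N, ∀ n, (X n).IsApprox N ε) :
    ∃ (Y : MMSpace) (φ : ℕ → ℕ), StrictMono φ ∧ Y.mass < ∞ ∧ GromovWeak (X ∘ φ) Y := by
  classical
  set e : ℕ → ℝ := fun l => 2⁻¹ ^ l with he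
  have he0 : ∀ l, 0 < e l := fun l => by positivity
  have hel : Tendsto e atTop (𝓝 0) :=
    tendsto_pow_atTop_nhds_zero_of_lt_one (by norm_num) (by norm_num)
  have hanti : ∀ {k l : ℕ}, k ≤ l → e l ≤ e k := fun hkl =>
    pow_le_pow_of_le_one (by norm_num) (by norm_num) hkl
  choose N hN using fun l => h (e l) (he0 l)
  choose p hp1 hp2 using fun n l => (hN l n).2
  -- all the approximating points together with the root
  let P : ∀ n, Option (ℕ × ℕ) → (X n).carrier := fun n a =>
    a.elim (X n).root fun li => p n li.1 li.2
  let C : Option (ℕ × ℕ) → ℝ := fun a => a.elim 0 fun li => N li.1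
  have hPC : ∀ n a, dist (X n).root (P n a) ≤ C a := by
    rintro n (_ | ⟨l, i⟩)
    · simp [P, C]
    · exact hp1 n l i
  obtain ⟨φ, D, hφ, hD⟩ := exists_subseq_tendsto_dist X P (fun a b => C a + C b) fun n a b =>
    (dist_triangle_left _ _ (X n).root).trans (add_le_add (hPC n a) (hPC n b))
  obtain ⟨Y, _, _, _, q, hq⟩ := exists_polish_of_pseudoMetric D
    (fun a => tendsto_nhds_unique (hD a a) (by simp))
    (fun a b => tendsto_nhds_unique (hD a b) (by simpa only [dist_comm] using hD b a))
    (fun a b c => le_of_tendsto_of_tendsto' (hD a c) ((hD a b).add (hD b c))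
      fun n => dist_triangle _ _ _)
  let A : ℕ → Finset (Option (ℕ × ℕ)) := fun l => insert none
    ((Finset.range (l + 1)).biUnion fun k => (Finset.range (N k + 1)).image fun i => some (k, i))
  have hA : ∀ {l k i : ℕ}, k ≤ l → i ≤ N k → some (k, i) ∈ A l := by
    intro l k i hk hi
    refine Finset.mem_insert_of_mem
      (Finset.mem_biUnion.2 ⟨k, by simpa [Nat.lt_succ_iff] using hk, ?_⟩)
    exact Finset.mem_image.2 ⟨i, by simpa [Nat.lt_succ_iff] using hi, rfl⟩
  have hA0 : ∀ l, none ∈ A l := fun l => Finset.mem_insert_self _ _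
  -- a further subsequence along which the distances at level `l` are within `e l` of their limits
  obtain ⟨ψ, hψ, hψD⟩ : ∃ ψ : ℕ → ℕ, StrictMono ψ ∧ ∀ l, ∀ a ∈ A l, ∀ b ∈ A l,
      |dist (P (φ (ψ l)) a) (P (φ (ψ l)) b) - D a b| < e l := by
    refine extraction_forall_of_eventually (P := fun l n => ∀ a ∈ A l, ∀ b ∈ A l,
      |dist (P (φ n) a) (P (φ n) b) - D a b| < e l) fun l => ?_
    rw [Filter.eventually_all_finset]
    intro a _
    rw [Filter.eventually_all_finset]
    intro b _
    have := (Metric.tendsto_nhds.1 (hD a b)) (e l) (he0 l)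
    simpa only [Real.dist_eq] using this
  set X' : ℕ → MMSpace := fun l => X (φ (ψ l)) with hX'
  let p' : ∀ l, ℕ → ℕ → (X' l).carrier := fun l => p (φ (ψ l))
  let ind : ∀ l, (X' l).carrier → ℕ := fun l x => SimpleFunc.nearestPtInd (p' l l) (N l) x
  let T : ∀ l, (X' l).carrier → Y := fun l x => q (some (l, ind l x))
  let G : ∀ l, ℕ → Set (X' l).carrier := fun l k => {x | ∃ i < N k, dist x (p' l k i) ≤ e k}
  have hGm : ∀ l k, MeasurableSet (G l k) := by
    intro l k
    have : G l k = ⋃ i ∈ Finset.range (N k), Metric.closedBall (p' l k i) (e k) := by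
      ext x; simp [G]
    rw [this]
    exact Finset.measurableSet_biUnion _ fun i _ => Metric.isClosed_closedBall.measurableSet
  have hG : ∀ l k, (X' l).μ (G l k)ᶜ ≤ ENNReal.ofReal (e k) := by
    intro l k
    refine (measure_mono fun x hx i hi => ?_).trans (hp2 (φ (ψ l)) k)
    by_contra hcon
    exact hx ⟨i, hi, not_lt.1 hcon⟩
  have hindN : ∀ l x, ind l x ≤ N l := fun l x => SimpleFunc.nearestPtInd_le _ _ _
  have hnear : ∀ l, ∀ x ∈ G l l, dist x (p' l l (ind l x)) ≤ e l := by
    rintro l x ⟨i, hi, hx⟩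
    have h1 := SimpleFunc.edist_nearestPt_le (p' l l) x hi.le
    have h2 : SimpleFunc.nearestPt (p' l l) (N l) x = p' l l (ind l x) := rfl
    rw [h2, edist_dist, edist_dist, ENNReal.ofReal_le_ofReal_iff dist_nonneg, dist_comm,
      dist_comm _ x] at h1
    exact h1.trans hx
  -- measures and distances along `T l`
  let _ : MeasurableSpace Y := _root_.borel Y
  have : BorelSpace Y := ⟨rfl⟩
  have : Nonempty Y := ⟨q none⟩
  have hT : ∀ l, Measurable (T l) := fun l =>
    (measurable_from_nat (f := fun i => q (some (l, i)))).comp (SimpleFunc.measurable _)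
  have hM : ∀ l, (X' l).mass ≤ N 0 := fun l => (hN 0 _).1
  have hfin : ∀ l, IsFiniteMeasure (X' l).μ := fun l => ⟨(hM l).trans_lt (by simp)⟩
  let ν : ℕ → FiniteMeasure Y := fun l => ⟨(X' l).μ.map (T l), inferInstance⟩
  have hdist : ∀ l, ∀ x ∈ G l l, ∀ a ∈ A l,
      |dist (P (φ (ψ l)) a) x - dist (q a) (T l x)| ≤ 2 * e l := by
    intro l x hx a ha
    have h1 := hψD l a ha (some (l, ind l x)) (hA le_rfl (hindN l x))
    have h2 := hnear l x hx
    have h3 : P (φ (ψ l)) (some (l, ind l x)) = p' l l (ind l x) := rfl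
    rw [h3] at h1
    have h4 := abs_dist_sub_le x (p' l l (ind l x)) (P (φ (ψ l)) a)
    rw [dist_comm x (P _ _), dist_comm (p' l l (ind l x)) (P _ _)] at h4
    rw [hq]
    rw [abs_le] at h4 ⊢
    rw [abs_lt] at h1
    constructor <;> linarith
  have hdist2 : ∀ l, ∀ x ∈ G l l, ∀ y ∈ G l l, |dist x y - dist (T l x) (T l y)| ≤ 3 * e l := by
    intro l x hx y hy
    have h1 := hdist l y hy (some (l, ind l x)) (hA le_rfl (hindN l x))
    have h3 : P (φ (ψ l)) (some (l, ind l x)) = p' l l (ind l x) := rfl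
    rw [h3] at h1
    have h4 := abs_dist_sub_le x (p' l l (ind l x)) y
    have h2 := hnear l x hx
    change |_ - dist (T l x) (T l y)| ≤ _ at h1
    rw [abs_le] at h1 h4 ⊢
    constructor <;> linarith
  have htight : ∀ l k, (ν l : Measure Y)
      (⋃ y ∈ (A k).image q, Metric.closedBall y (3 * e k))ᶜ ≤ 2 * 2⁻¹ ^ k := by
    intro l k
    have hm : MeasurableSet (⋃ y ∈ (A k).image q, Metric.closedBall y (3 * e k)) :=
      Finset.measurableSet_biUnion _ fun i _ => Metric.isClosed_closedBall.measurableSet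
    change ((X' l).μ.map (T l)) _ ≤ _
    rw [Measure.map_apply (hT l) hm.compl]
    have hmem : ∀ (a : Option (ℕ × ℕ)) (x : (X' l).carrier), a ∈ A k →
        dist (q a) (T l x) ≤ 3 * e k →
        x ∉ T l ⁻¹' (⋃ y ∈ (A k).image q, Metric.closedBall y (3 * e k))ᶜ := by
      intro a x ha hx hcon
      refine hcon (mem_iUnion₂.2 ⟨q a, Finset.mem_image_of_mem q ha, ?_⟩)
      rwa [Metric.mem_closedBall, dist_comm]
    have h3 := (he0 k).le
    rcases le_or_gt k l with hkl | hkl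
    · have hsub : T l ⁻¹' (⋃ y ∈ (A k).image q, Metric.closedBall y (3 * e k))ᶜ ⊆
          (G l l)ᶜ ∪ (G l k)ᶜ := by
        intro x hx
        by_contra hcon
        simp only [mem_union, mem_compl_iff, not_or, not_not] at hcon
        obtain ⟨i, hi, hxi⟩ := hcon.2
        refine hmem (some (k, i)) x (hA le_rfl hi.le) ?_ hx
        have h1 := hdist l x hcon.1 (some (k, i)) (hA hkl hi.le)
        have h2 : P (φ (ψ l)) (some (k, i)) = p' l k i := rfl
        rw [h2, dist_comm _ x, abs_le] at h1
        have := hanti hkl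
        linarith [h1.1]
      refine (measure_mono hsub).trans ((measure_union_le _ _).trans
        ((add_le_add (hG l l) (hG l k)).trans ?_))
      have h5 : ENNReal.ofReal (e k) = 2⁻¹ ^ k := by
        rw [he, ENNReal.ofReal_pow (by norm_num), ENNReal.ofReal_inv_of_pos two_pos]
        norm_num
      rw [two_mul, ← h5]
      exact add_le_add (ENNReal.ofReal_le_ofReal (hanti hkl)) le_rfl
    · have hsub : T l ⁻¹' (⋃ y ∈ (A k).image q, Metric.closedBall y (3 * e k))ᶜ ⊆ ∅ := by
        intro x hx
        refine hmem (some (l, ind l x)) x (hA hkl.le (hindN l x)) ?_ hx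
        change dist (T l x) (T l x) ≤ _
        rw [dist_self]
        positivity
      rw [subset_empty_iff.1 hsub, measure_empty]
      exact zero_le
  have h3e : Tendsto (fun l => 3 * e l) atTop (𝓝 0) := by simpa using hel.const_mul 3
  obtain ⟨κ, χ, hχ, hκ⟩ := exists_subseq_tendsto_of_near_finite (fun k => (A k).image q) h3e ν
    (N 0) (fun l => by
      rw [← ENNReal.coe_le_coe, FiniteMeasure.ennreal_mass]
      change ((X' l).μ.map (T l)) univ ≤ _
      rw [Measure.map_apply (hT l) MeasurableSet.univ]
      exact hM l) htight
  let Z : MMSpace :=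
    { carrier := Y, root := q none, μ := κ, boundedlyFinite := fun s _ => measure_lt_top _ _ }
  refine ⟨Z, φ ∘ ψ ∘ χ, hφ.comp (hψ.comp hχ), measure_lt_top (κ : Measure Y) univ, ?_⟩
  refine gromovWeak_of_almost_isometries (X := X' ∘ χ) (Y := Z) (fun n => T (χ n))
    (fun n => hT _) (M := N 0) (fun n => hM _) (ε := fun n => 3 * e (χ n))
    (fun n => by have := he0 (χ n); positivity) (h3e.comp hχ.tendsto_atTop)
    (fun n => G (χ n) (χ n)) (fun n => hGm _ _) (fun n => (hG _ _).trans
      (ENNReal.ofReal_le_ofReal ?_)) (fun n => hdist2 _) (fun n x hx => ?_)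
    (ν := ν ∘ χ) (κ := κ) (fun n => rfl) rfl hκ
  · have := he0 (χ n)
    linarith
  · refine (hdist _ x hx none (hA0 _)).trans ?_
    have := he0 (χ n)
    linarith

end MMSpace

/-! ### Necessity: convergent sequences are uniformly approximable -/

namespace MMSpace

/-- A continuous majorant of the indicator of `[ε, ∞)` that is less than `1` on `[0, ε)`. -/
noncomputable def ramp (ε : ℝ≥0) (t : ℝ≥0) : ℝ≥0 := min 1 (t / ε)

theorem continuous_ramp (ε : ℝ≥0) : Continuous (ramp ε) :=
  continuous_const.min (continuous_id.div_const ε)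

theorem ramp_le_one (ε t : ℝ≥0) : ramp ε t ≤ 1 := min_le_left _ _

theorem ramp_eq_one {ε t : ℝ≥0} (hε : 0 < ε) (h : ε ≤ t) : ramp ε t = 1 :=
  min_eq_left ((one_le_div hε).2 h)

theorem ramp_lt_one {ε t : ℝ≥0} (hε : 0 < ε) (h : t < ε) : ramp ε t < 1 :=
  (min_le_right _ _).trans_lt ((div_lt_one hε).2 h)

/-- An integral over `N + 1` sampled points. Up to normalisation it is a continuous upper bound for
the expected mass left uncovered by the open `ε`-balls around the last `N` of them. -/
noncomputable def uncovered (X : MMSpace) (ε : ℝ≥0) (N : ℕ) : ℝ≥0∞ :=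
  ∫⁻ x, ((∏ i : Fin N, ramp ε (X.distMatrix (N + 1) x (Fin.succ 0) i.succ.succ) : ℝ≥0) : ℝ≥0∞)
    ∂(Measure.pi fun _ : Fin (N + 1) => X.μ)

theorem GromovWeak.tendsto_uncovered {X : ℕ → MMSpace} {Y : MMSpace} (h : GromovWeak X Y)
    (ε : ℝ≥0) (N : ℕ) :
    Tendsto (fun n => (X n).uncovered ε N) atTop (𝓝 (Y.uncovered ε N)) := by
  refine h.tendsto_lintegral (N + 1)
    (f := fun d => ∏ i : Fin N, ramp ε (d (Fin.succ 0) i.succ.succ)) ?_ (C := 1) ?_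
  · exact continuous_finsetProd _ fun i _ =>
      (continuous_ramp ε).comp ((continuous_apply _).comp (continuous_apply _))
  · intro d
    exact Finset.prod_le_one (fun _ _ => zero_le) fun i _ => ramp_le_one _ _

theorem uncovered_eq_lintegral_prod (X : MMSpace) (ε : ℝ≥0) (N : ℕ) :
    X.uncovered ε N = ∫⁻ z, ∏ i : Fin N, (ramp ε (nndist z.1 (z.2 i)) : ℝ≥0∞)
      ∂(X.μ.prod (Measure.pi fun _ : Fin N => X.μ)) := by
  have hmp := (measurePreserving_piFinSuccAbove (fun _ : Fin (N + 1) => X.μ) 0)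
  rw [← hmp.lintegral_comp_emb (MeasurableEquiv.measurableEmbedding _)]
  refine lintegral_congr fun x => ?_
  rw [ENNReal.ofNNReal_finsetProd]
  refine Finset.prod_congr rfl fun i _ => ?_
  simp [distMatrix, MeasurableEquiv.piFinSuccAbove, Fin.insertNthEquiv, Fin.tail]

theorem measurable_ramp_nndist (X : MMSpace) (ε : ℝ≥0) (N : ℕ) :
    Measurable fun z : X.carrier × (Fin N → X.carrier) =>
      ∏ i : Fin N, (ramp ε (nndist z.1 (z.2 i)) : ℝ≥0∞) := by
  refine Finset.measurable_prod _ fun i _ => ?_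
  refine Measurable.coe_nnreal_ennreal ?_
  exact (continuous_ramp ε).measurable.comp
    (measurable_fst.nndist ((measurable_pi_apply i).comp measurable_snd))

theorem uncovered_eq_lintegral_pow (X : MMSpace) (ε : ℝ≥0) (N : ℕ) :
    X.uncovered ε N = ∫⁻ y, (∫⁻ x, (ramp ε (nndist y x) : ℝ≥0∞) ∂X.μ) ^ N ∂X.μ := by
  rw [uncovered_eq_lintegral_prod, lintegral_prod _ (X.measurable_ramp_nndist ε N).aemeasurable]
  refine lintegral_congr fun y => ?_
  refine (lintegral_fin_prod_eq_prod X.μ (f := fun _ x => (ramp ε (nndist y x) : ℝ≥0∞))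
    fun i => ?_).trans (by simp)
  exact ((continuous_ramp ε).comp
    (continuous_const.nndist continuous_id)).measurable.coe_nnreal_ennreal

/-- Some choice of `N` points leaves at most the average mass uncovered. -/
theorem exists_mul_le_uncovered (X : MMSpace) (hX : X.mass < ∞) (h0 : X.mass ≠ 0) {ε : ℝ≥0}
    (hε : 0 < ε) (N : ℕ) : ∃ p : Fin N → X.carrier,
      X.μ {x | ∀ i, (ε : ℝ) ≤ dist x (p i)} * X.mass ^ N ≤ X.uncovered ε N := by
  have hfin : IsFiniteMeasure X.μ := ⟨hX⟩
  rw [uncovered_eq_lintegral_prod,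
    lintegral_prod_symm _ (X.measurable_ramp_nndist ε N).aemeasurable]
  set P := Measure.pi fun _ : Fin N => X.μ
  have hPu : P univ = X.mass ^ N := by simp [P, Measure.pi_univ, mass]
  have hP : P ≠ 0 := by
    intro hcon
    rw [hcon] at hPu
    exact pow_ne_zero N h0 hPu.symm
  have hm : Measurable fun p : Fin N → X.carrier =>
      ∫⁻ x, ∏ i : Fin N, (ramp ε (nndist x (p i)) : ℝ≥0∞) ∂X.μ :=
    (X.measurable_ramp_nndist ε N).lintegral_prod_left'
  obtain ⟨p, hp⟩ := exists_le_laverage hP hm.aemeasurable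
  refine ⟨p, ?_⟩
  rw [laverage_eq, hPu] at hp
  have h1 : X.μ {x | ∀ i, (ε : ℝ) ≤ dist x (p i)} ≤
      ∫⁻ x, ∏ i : Fin N, (ramp ε (nndist x (p i)) : ℝ≥0∞) ∂X.μ := by
    have hms : MeasurableSet {x | ∀ i, (ε : ℝ) ≤ dist x (p i)} := by
      simp only [ofPred_forall]
      exact MeasurableSet.iInter fun i =>
        (isClosed_le continuous_const (continuous_id.dist continuous_const)).measurableSet
    rw [← lintegral_indicator_one hms]
    refine lintegral_mono fun x => ?_
    by_cases hx : x ∈ {x | ∀ i, (ε : ℝ) ≤ dist x (p i)}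
    · rw [indicator_of_mem hx, Finset.prod_eq_one]
      · rfl
      · intro i _
        rw [ramp_eq_one hε, ENNReal.coe_one]
        have := hx i
        rwa [← coe_nndist, NNReal.coe_le_coe] at this
    · rw [indicator_of_notMem hx]
      exact zero_le
  refine (mul_le_mul_left (h1.trans hp) _).trans ?_
  rw [ENNReal.div_mul_cancel (pow_ne_zero N h0) (ENNReal.pow_ne_top hX.ne)]

/-- For a finite measure, `N` sampled points cover all but an arbitrarily small part of the mass
as `N` grows, since `ε`-balls around points of the support have positive mass. -/
theorem exists_uncovered_lt (X : MMSpace) (hX : X.mass < ∞) (h0 : X.mass ≠ 0) {ε : ℝ≥0}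
    (hε : 0 < ε) {δ : ℝ≥0∞} (hδ : 0 < δ) : ∃ N, X.uncovered ε N < δ * X.mass ^ N := by
  have hfin : IsFiniteMeasure X.μ := ⟨hX⟩
  set g : X.carrier → ℝ≥0∞ := fun y => ∫⁻ x, (ramp ε (nndist y x) : ℝ≥0∞) ∂X.μ with hg
  have hgm : Measurable g := by
    refine Measurable.lintegral_prod_right' (ν := X.μ)
      (f := fun z : X.carrier × X.carrier => (ramp ε (nndist z.1 z.2) : ℝ≥0∞)) ?_
    exact ((continuous_ramp ε).measurable.comp measurable_nndist).coe_nnreal_ennreal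
  have hg1 : ∀ y, g y ≤ X.mass := by
    intro y
    refine (lintegral_mono fun x => ENNReal.coe_le_coe.2 (ramp_le_one ε _)).trans ?_
    simp [mass]
  have hglt : ∀ᵐ y ∂X.μ, g y < X.mass := by
    filter_upwards [Measure.support_mem_ae (μ := X.μ)] with y hy
    have h1 : X.μ (Metric.ball y ε) ≠ 0 :=
      ((Measure.mem_support_iff_forall y).1 hy _
        (Metric.ball_mem_nhds y (by exact_mod_cast hε))).ne'
    have h2 := lintegral_strict_mono_of_ae_le_of_ae_lt_on (μ := X.μ)
      (f := fun x => (ramp ε (nndist y x) : ℝ≥0∞)) (g := fun _ => 1) aemeasurable_const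
      (((hg1 y).trans_lt hX).ne)
      (Eventually.of_forall fun x => ENNReal.coe_le_coe.2 (ramp_le_one ε _)) h1
      (Eventually.of_forall fun x hx => by
        have : nndist y x < ε := by
          rw [← NNReal.coe_lt_coe, coe_nndist, dist_comm]
          exact hx
        exact_mod_cast ramp_lt_one hε this)
    simpa [mass] using h2
  have hlim : Tendsto (fun N : ℕ => ∫⁻ y, (g y * X.mass⁻¹) ^ N ∂X.μ) atTop (𝓝 (∫⁻ _, 0 ∂X.μ)) := by
    refine tendsto_lintegral_of_dominated_convergence (fun _ => 1)
      (fun N => (hgm.mul_const _).pow_const N) (fun N => Eventually.of_forall fun y => ?_)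
      (by simp) ?_
    · refine pow_le_one₀ zero_le ?_
      rw [← div_eq_mul_inv]
      exact ENNReal.div_le_of_le_mul (by simpa using hg1 y)
    · filter_upwards [hglt] with y hy
      refine ENNReal.tendsto_pow_atTop_nhds_zero_of_lt_one ?_
      rw [← div_eq_mul_inv]
      exact (ENNReal.div_lt_iff (Or.inl h0) (Or.inl hX.ne)).2 (by simpa using hy)
  rw [lintegral_zero] at hlim
  obtain ⟨N, hN⟩ := (hlim.eventually_lt_const hδ).exists
  refine ⟨N, ?_⟩
  rw [uncovered_eq_lintegral_pow]
  simp only [mul_pow] at hN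
  rw [lintegral_mul_const _ (hgm.pow_const N)] at hN
  rw [← ENNReal.inv_pow, ← div_eq_mul_inv] at hN
  exact (ENNReal.div_lt_iff (Or.inl (pow_ne_zero N h0)) (Or.inl (ENNReal.pow_ne_top hX.ne))).1 hN

theorem GromovWeak.eventually_exists_cover {X : ℕ → MMSpace} {Y : MMSpace} (h : GromovWeak X Y)
    (hX : ∀ n, (X n).mass < ∞) (hY : Y.mass < ∞) {ε : ℝ≥0} (hε : 0 < ε) {δ : ℝ≥0∞} (hδ : 0 < δ)
    (hδt : δ ≠ ∞) :
    ∃ N : ℕ, ∀ᶠ n in atTop, ∃ p : ℕ → (X n).carrier,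
      (X n).μ {x | ∀ i < N, (ε : ℝ) < dist x (p i)} ≤ δ := by
  by_cases h0 : Y.mass = 0
  · refine ⟨0, ?_⟩
    have := h.tendsto_mass
    rw [h0] at this
    filter_upwards [this.eventually_lt_const hδ] with n hn
    exact ⟨fun _ => (X n).root, (measure_mono (subset_univ _)).trans hn.le⟩
  · obtain ⟨N, hN⟩ := Y.exists_uncovered_lt hY h0 hε hδ
    refine ⟨N, ?_⟩
    have h1 : Tendsto (fun n => δ * (X n).mass ^ N) atTop (𝓝 (δ * Y.mass ^ N)) :=
      ENNReal.Tendsto.const_mul (((ENNReal.continuous_pow N).tendsto _).comp h.tendsto_mass)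
        (Or.inr hδt)
    filter_upwards [(h.tendsto_uncovered ε N).eventually_lt h1 hN,
      h.tendsto_mass.eventually_ne h0] with n hn hn0
    obtain ⟨p, hp⟩ := (X n).exists_mul_le_uncovered (hX n) hn0 hε N
    refine ⟨fun i => if hi : i < N then p ⟨i, hi⟩ else (X n).root, ?_⟩
    refine (measure_mono fun x hx i => ?_).trans (lt_of_mul_lt_mul_right' (hp.trans_lt hn)).le
    have := (hx i i.2).le
    simpa using this

/-- Along a Gromov-weakly convergent sequence of finite spaces, `N` sampled points eventually cover
as much mass as they do for the limit, and the mass far from the root is controlled by that of the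
limit. -/
theorem GromovWeak.eventually_isApprox {X : ℕ → MMSpace} {Y : MMSpace} (h : GromovWeak X Y)
    (hX : ∀ n, (X n).mass < ∞) (hY : Y.mass < ∞) {ε : ℝ} (hε : 0 < ε) :
    ∃ N, ∀ᶠ n in atTop, (X n).IsApprox N ε := by
  have hYf : IsFiniteMeasure Y.μ := ⟨hY⟩
  obtain ⟨M, hM⟩ := ENNReal.exists_nat_gt hY.ne
  have hδ : (0 : ℝ≥0∞) < ENNReal.ofReal (ε / 2) := ENNReal.ofReal_pos.2 (by positivity)
  obtain ⟨N, hN⟩ := h.eventually_exists_cover hX hY (ε := ⟨ε, hε.le⟩) hε hδ ENNReal.ofReal_ne_top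
  -- little mass is far from the root
  obtain ⟨k, hk⟩ : ∃ k : ℕ, ∫⁻ x, ((1 - cutoff k (nndist Y.root x) : ℝ≥0) : ℝ≥0∞) ∂Y.μ <
      ENNReal.ofReal (ε / 2) := by
    have hlim : Tendsto (fun k : ℕ => ∫⁻ x, ((1 - cutoff k (nndist Y.root x) : ℝ≥0) : ℝ≥0∞) ∂Y.μ)
        atTop (𝓝 (∫⁻ _, 0 ∂Y.μ)) := by
      refine tendsto_lintegral_of_dominated_convergence (fun _ => 1)
        (fun k => (measurable_const.sub (Y.measurable_radial _)).coe_nnreal_ennreal)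
        (fun k => Eventually.of_forall fun x => ?_) (by simp)
        (Eventually.of_forall fun x => ?_)
      · exact ENNReal.coe_le_coe.2 tsub_le_self
      · refine tendsto_const_nhds.congr' ?_
        obtain ⟨k0, hk0⟩ := exists_nat_ge (dist Y.root x)
        filter_upwards [eventually_ge_atTop k0] with k hk
        rw [cutoff_eq_one, tsub_self, ENNReal.coe_zero]
        exact hk0.trans (by exact_mod_cast hk)
    rw [lintegral_zero] at hlim
    exact (hlim.eventually_lt_const hδ).exists
  have htail : ∀ᶠ n in atTop,
      (X n).μ {x | (k : ℝ) + 1 < dist (X n).root x} ≤ ENNReal.ofReal (ε / 2) := by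
    have hcont : Continuous fun d : Fin 2 → Fin 2 → ℝ≥0 => 1 - cutoff k (d 0 1) :=
      continuous_const.sub ((cutoff k).continuous.comp
        ((continuous_apply _).comp (continuous_apply _)))
    have h1 := h.tendsto_lintegral 1 hcont (C := 1) fun d => tsub_le_self
    have h2 : ∀ Z : MMSpace, ∫⁻ x, ((1 - cutoff k (Z.distMatrix 1 x 0 1) : ℝ≥0) : ℝ≥0∞)
        ∂(Measure.pi fun _ : Fin 1 => Z.μ) =
        ∫⁻ x, ((1 - cutoff k (nndist Z.root x) : ℝ≥0) : ℝ≥0∞) ∂Z.μ := by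
      intro Z
      rw [← (measurePreserving_funUnique Z.μ (Fin 1)).lintegral_comp_emb
        (MeasurableEquiv.measurableEmbedding _)]
      refine lintegral_congr fun x => ?_
      simp [distMatrix]
    rw [h2] at h1
    filter_upwards [h1.eventually_lt_const hk] with n hn
    refine le_trans ?_ (hn.le.trans' (h2 (X n)).ge)
    have hms : MeasurableSet {x | (k : ℝ) + 1 < dist (X n).root x} :=
      (isOpen_lt continuous_const (continuous_const.dist continuous_id)).measurableSet
    rw [← lintegral_indicator_one hms]
    refine lintegral_mono fun x => ?_
    by_cases hx : x ∈ {x | (k : ℝ) + 1 < dist (X n).root x}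
    · rw [indicator_of_mem hx, cutoff_eq_zero (by rw [coe_nndist]; exact hx.le)]
      simp
    · rw [indicator_of_notMem hx]
      exact zero_le
  refine ⟨N + M + ⌈k + 1 + ε⌉₊, ?_⟩
  filter_upwards [hN, htail, h.tendsto_mass.eventually_lt_const hM] with n hn ht hm
  refine ⟨hm.le.trans (by exact_mod_cast (by omega)), ?_⟩
  obtain ⟨p, hp⟩ := hn
  have hceil : (k : ℝ) + 1 + ε ≤ ((N + M + ⌈(k : ℝ) + 1 + ε⌉₊ : ℕ) : ℝ) := by
    refine (Nat.le_ceil _).trans ?_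
    exact_mod_cast Nat.le_add_left _ _
  -- points too far from the root are not needed
  classical
  refine ⟨fun i => if dist (X n).root (p i) ≤ k + 1 + ε then p i else (X n).root, fun i => ?_, ?_⟩
  · dsimp only
    split_ifs with hi
    · exact hi.trans hceil
    · rw [dist_self]
      positivity
  · have hsub : {x | ∀ i < N + M + ⌈(k : ℝ) + 1 + ε⌉₊,
        ε < dist x (if dist (X n).root (p i) ≤ k + 1 + ε then p i else (X n).root)} ⊆
        {x | ∀ i < N, ε < dist x (p i)} ∪ {x | (k : ℝ) + 1 < dist (X n).root x} := by
      intro x hx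
      rcases lt_or_ge ((k : ℝ) + 1) (dist (X n).root x) with hd | hd
      · exact Or.inr hd
      · refine Or.inl fun i hi => ?_
        have h1 := hx i (by omega)
        split_ifs at h1 with h2
        · exact h1
        · have := dist_triangle (X n).root x (p i)
          linarith
    refine (measure_mono hsub).trans ((measure_union_le _ _).trans ((add_le_add hp ht).trans ?_))
    rw [← ENNReal.ofReal_add (by positivity) (by positivity), add_halves]

end MMSpace

/-! ### Gromov-vague limits of locally approximable sequences -/

/-- For any bounds `a j` there is a strictly positive, bounded, continuous weight that is a
combination of the cutoffs with coefficients so small that bounds `a j` on the mass at radius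
`j + 1` become summable. -/
theorem exists_radial_weight (a : ℕ → ℕ) : ∃ w : C(ℝ≥0, ℝ≥0), (∀ t, 0 < w t) ∧ (∀ t, w t ≤ 2) ∧
    ∀ t, (w t : ℝ≥0∞) = ∑' j, ((4⁻¹ ^ j / (1 + a j) : ℝ≥0) : ℝ≥0∞) * MMSpace.cutoff j t := by
  set b : ℕ → ℝ≥0 := fun j => 4⁻¹ ^ j / (1 + a j) with hb
  have hb0 : ∀ j, 0 < b j := fun j => by positivity
  have hb2 : ∀ j, b j ≤ 2⁻¹ ^ j := by
    intro j
    refine (div_le_self zero_le (by simp)).trans ?_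
    refine pow_le_pow_left₀ zero_le ?_ j
    rw [← NNReal.coe_le_coe]; norm_num
  have hsum2 : Summable fun j : ℕ => (2⁻¹ : ℝ≥0) ^ j := by
    refine NNReal.summable_geometric ?_
    rw [← NNReal.coe_lt_coe]; norm_num
  have hle : ∀ j t, b j * MMSpace.cutoff j t ≤ 2⁻¹ ^ j := fun j t =>
    (mul_le_of_le_one_right zero_le (MMSpace.cutoff_le_one j t)).trans (hb2 j)
  have hsum : ∀ t, Summable fun j => b j * MMSpace.cutoff j t := fun t =>
    NNReal.summable_of_le (fun j => hle j t) hsum2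
  have hcont : Continuous fun t => ∑' j, b j * MMSpace.cutoff j t := by
    refine NNReal.isEmbedding_coe.continuous_iff.2 ?_
    have : (NNReal.toReal ∘ fun t => ∑' j, b j * MMSpace.cutoff j t) =
        fun t => ∑' j, ((b j * MMSpace.cutoff j t : ℝ≥0) : ℝ) := by
      funext t
      exact NNReal.coe_tsum
    rw [this]
    refine continuous_tsum (u := fun j => (((2⁻¹ : ℝ≥0) ^ j : ℝ≥0) : ℝ)) (fun j => ?_)
      (NNReal.summable_coe.2 hsum2) fun j t => ?_
    · exact NNReal.continuous_coe.comp (continuous_const.mul (MMSpace.cutoff j).continuous)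
    · rw [NNReal.norm_eq]
      exact hle j t
  refine ⟨⟨_, hcont⟩, fun t => ?_, fun t => ?_, fun t => ?_⟩
  · obtain ⟨k, hk⟩ := exists_nat_ge (t : ℝ)
    have h1 : b k * MMSpace.cutoff k t ≤ ∑' j, b j * MMSpace.cutoff j t :=
      (hsum t).le_tsum k fun _ _ => zero_le
    rw [MMSpace.cutoff_eq_one hk, mul_one] at h1
    exact (hb0 k).trans_le h1
  · refine ((hsum t).tsum_le_tsum (fun j => hle j t) hsum2).trans ?_
    rw [NNReal.tsum_geometric (by rw [← NNReal.coe_lt_coe]; norm_num)]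
    refine le_of_eq ?_
    rw [← NNReal.coe_inj, NNReal.coe_inv, NNReal.coe_sub (by rw [← NNReal.coe_le_coe]; norm_num)]
    norm_num
  · change ((∑' j, b j * MMSpace.cutoff j t : ℝ≥0) : ℝ≥0∞) = _
    rw [ENNReal.coe_tsum (hsum t)]
    simp only [ENNReal.coe_mul, hb]

namespace MMSpace

theorem IsApprox.restr {X : MMSpace} {N : ℕ} {ε : ℝ} (h : X.IsApprox N ε) (R : ℝ) :
    (X.restr R).IsApprox N ε := by
  obtain ⟨h1, p, h2, h3⟩ := h
  have hle : ∀ s : Set X.carrier, (X.restr R).μ s ≤ X.μ s := fun s => Measure.restrict_apply_le _ s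
  exact ⟨(hle univ).trans h1, p, h2, (hle _).trans h3⟩

theorem IsApprox.restr_of_weight_cutoff {X : MMSpace} {k N : ℕ} {ε R : ℝ}
    (h : (X.weight (cutoff k)).IsApprox N ε) (hR : R ≤ k) : (X.restr R).IsApprox N ε := by
  have := h.restr R
  rwa [weight_restr _ fun t ht => cutoff_eq_one (ht.trans hR)] at this

theorem weight_apply (X : MMSpace) (w : C(ℝ≥0, ℝ≥0)) {s : Set X.carrier} (hs : MeasurableSet s) :
    (X.weight w).μ s = ∫⁻ x in s, (w (nndist X.root x) : ℝ≥0∞) ∂X.μ :=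
  withDensity_apply _ hs

theorem setLIntegral_cutoff_le {X : MMSpace} {a : ℕ → ℕ}
    (ha : ∀ j : ℕ, (X.restr (j + 1)).mass ≤ a j) (s : Set X.carrier) (j : ℕ) :
    ∫⁻ x in s, ((4⁻¹ ^ j / (1 + a j) : ℝ≥0) : ℝ≥0∞) * cutoff j (nndist X.root x) ∂X.μ ≤
      4⁻¹ ^ j := by
  have hm : MeasurableSet (Metric.closedBall X.root ((j : ℝ) + 1)) :=
    Metric.isClosed_closedBall.measurableSet
  have h1 : ∫⁻ x in s, (cutoff j (nndist X.root x) : ℝ≥0∞) ∂X.μ ≤ a j := by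
    refine (setLIntegral_le_lintegral s _).trans (le_trans ?_ (ha j))
    have h2 : (X.restr ((j : ℝ) + 1)).mass = X.μ (Metric.closedBall X.root ((j : ℝ) + 1)) :=
      Measure.restrict_apply_univ _
    rw [h2, ← lintegral_indicator_one hm]
    refine lintegral_mono fun x => ?_
    by_cases hx : x ∈ Metric.closedBall X.root ((j : ℝ) + 1)
    · rw [indicator_of_mem hx]
      exact ENNReal.coe_le_coe.2 (cutoff_le_one _ _)
    · rw [indicator_of_notMem hx, cutoff_eq_zero, ENNReal.coe_zero]
      rw [coe_nndist, dist_comm]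
      exact (not_le.1 hx).le
  rw [lintegral_const_mul _ (X.measurable_radial _).coe_nnreal_ennreal]
  refine (mul_le_mul_right h1 _).trans ?_
  have h3 : (4⁻¹ ^ j / (1 + a j) : ℝ≥0) * (a j : ℝ≥0) ≤ 4⁻¹ ^ j := by
    rw [div_mul_eq_mul_div]
    refine (div_le_iff₀ (by positivity)).2 (mul_le_mul_right ?_ _)
    exact le_add_of_nonneg_left zero_le_one
  refine (ENNReal.coe_le_coe.2 h3).trans_eq' ?_ |>.trans_eq ?_
  · push_cast; rfl
  · push_cast
    rfl

/-- The weighted mass at distance at least `J` from the root decays geometrically in `J`. -/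
theorem setLIntegral_weight_le {X : MMSpace} {a : ℕ → ℕ}
    (ha : ∀ j : ℕ, (X.restr (j + 1)).mass ≤ a j) {w : C(ℝ≥0, ℝ≥0)}
    (hw : ∀ t, (w t : ℝ≥0∞) = ∑' j, ((4⁻¹ ^ j / (1 + a j) : ℝ≥0) : ℝ≥0∞) * cutoff j t)
    (J : ℕ) {s : Set X.carrier} (hm : MeasurableSet s) (hs : ∀ x ∈ s, (J : ℝ) ≤ dist X.root x) :
    (X.weight w).μ s ≤ 2 * 2⁻¹ ^ J := by
  rw [weight_apply _ _ hm]
  simp only [hw]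
  rw [lintegral_tsum fun j => ((X.measurable_radial _).coe_nnreal_ennreal.const_mul _).aemeasurable]
  have h4 : ∀ j : ℕ, (4⁻¹ : ℝ≥0∞) ^ j = 2⁻¹ ^ j * 2⁻¹ ^ j := by
    intro j
    rw [← mul_pow, ← ENNReal.mul_inv (by simp) (by simp)]
    norm_num
  have h1 : ∀ j : ℕ, ∫⁻ x in s,
      ((4⁻¹ ^ j / (1 + a j) : ℝ≥0) : ℝ≥0∞) * cutoff j (nndist X.root x) ∂X.μ ≤
      2⁻¹ ^ J * 2⁻¹ ^ j := by
    intro j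
    rcases lt_or_ge j J with hj | hj
    · -- the cutoff at `j < J` vanishes at distance at least `J`
      rw [setLIntegral_congr_fun (g := fun _ => 0) hm, lintegral_zero]
      · exact zero_le
      · intro x hx
        have : cutoff j (nndist X.root x) = 0 :=
          cutoff_eq_zero ((by exact_mod_cast hj : (j : ℝ) + 1 ≤ J).trans (hs x hx))
        simp [this]
    · refine (setLIntegral_cutoff_le ha s j).trans ?_
      rw [h4]
      refine mul_le_mul_left (pow_le_pow_of_le_one zero_le ?_ hj) _
      simp
  refine (ENNReal.tsum_le_tsum h1).trans ?_
  rw [ENNReal.tsum_mul_left, ENNReal.tsum_geometric, ENNReal.one_sub_inv_two, inv_inv, mul_comm]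

/-- Under a weight that decays fast enough, approximability of the restrictions to all balls gives
approximability of the whole space: outside a large ball there is little weighted mass. -/
theorem exists_isApprox_weight {S : Set MMSpace} {a : ℕ → ℕ}
    (ha : ∀ X ∈ S, ∀ j : ℕ, (X.restr (j + 1)).mass ≤ a j)
    (h : ∀ (R : ℕ) (ε : ℝ), 0 < ε → ∃ N, ∀ X ∈ S, (X.restr R).IsApprox N ε)
    {w : C(ℝ≥0, ℝ≥0)} (hw2 : ∀ t, w t ≤ 2)
    (hw : ∀ t, (w t : ℝ≥0∞) = ∑' j, ((4⁻¹ ^ j / (1 + a j) : ℝ≥0) : ℝ≥0∞) * cutoff j t)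
    {ε : ℝ} (hε : 0 < ε) : ∃ N, ∀ X ∈ S, (X.weight w).IsApprox N ε := by
  obtain ⟨J, hJ⟩ : ∃ J : ℕ, (2 : ℝ≥0∞) * 2⁻¹ ^ J < ENNReal.ofReal (ε / 2) := by
    have h1 : Tendsto (fun J : ℕ => (2 : ℝ≥0∞) * 2⁻¹ ^ J) atTop (𝓝 (2 * 0)) :=
      ENNReal.Tendsto.const_mul (ENNReal.tendsto_pow_atTop_nhds_zero_of_lt_one (by simp))
        (Or.inr (by simp))
    rw [mul_zero] at h1
    exact (h1.eventually_lt_const (ENNReal.ofReal_pos.2 (by positivity))).exists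
  obtain ⟨N, hN⟩ := h J (ε / 4) (by positivity)
  refine ⟨N + 2, fun X hX => ?_⟩
  obtain ⟨-, p, hp1, hp2⟩ := (hN X hX).mono (Nat.le_add_right N 2) le_rfl
  refine ⟨?_, p, hp1, ?_⟩
  · refine (setLIntegral_weight_le (ha X hX) hw 0 MeasurableSet.univ fun x _ => ?_).trans ?_
    · simp
    · simp
  · set U : Set X.carrier := {x | ∀ i < N + 2, ε / 4 < dist x (p i)} with hU
    have hUm : MeasurableSet U := by
      simp only [hU, ofPred_forall]
      exact MeasurableSet.iInter fun i => MeasurableSet.iInter fun _ =>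
        (isOpen_lt continuous_const (continuous_id.dist continuous_const)).measurableSet
    have hBm : MeasurableSet (Metric.closedBall X.root (J : ℝ)) :=
      Metric.isClosed_closedBall.measurableSet
    have hin : (X.weight w).μ (U ∩ Metric.closedBall X.root J) ≤ ENNReal.ofReal (ε / 2) := by
      refine (X.weight_apply w (hUm.inter hBm)).trans_le ?_
      calc ∫⁻ x in U ∩ Metric.closedBall X.root J, (w (nndist X.root x) : ℝ≥0∞) ∂X.μ
          ≤ ∫⁻ _ in U ∩ Metric.closedBall X.root J, 2 ∂X.μ :=
            lintegral_mono fun x => ENNReal.coe_le_coe.2 (hw2 (nndist X.root x))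
        _ = 2 * (X.restr J).μ U := by
            rw [setLIntegral_const]
            congr 1
            exact (Measure.restrict_apply hUm).symm
        _ ≤ 2 * ENNReal.ofReal (ε / 4) := mul_le_mul_right hp2 _
        _ = ENNReal.ofReal (ε / 2) := by
            rw [← ENNReal.ofReal_ofNat, ← ENNReal.ofReal_mul (by norm_num)]
            congr 1
            ring
    have hout : (X.weight w).μ (Metric.closedBall X.root J)ᶜ ≤ ENNReal.ofReal (ε / 2) :=
      (setLIntegral_weight_le (ha X hX) hw J hBm.compl fun x hx => by
        rw [dist_comm]
        have hx' : ¬ dist x X.root ≤ J := hx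
        exact (not_le.1 hx').le).trans hJ.le
    have hsub : {x : X.carrier | ∀ i < N + 2, ε < dist x (p i)} ⊆
        (U ∩ Metric.closedBall X.root J) ∪ (Metric.closedBall X.root J)ᶜ := by
      intro x hx
      by_cases hxB : x ∈ Metric.closedBall X.root (J : ℝ)
      · exact Or.inl ⟨fun i hi => lt_trans (by linarith) (hx i hi), hxB⟩
      · exact Or.inr hxB
    refine (measure_mono hsub).trans ((measure_union_le _ _).trans ((add_le_add hin hout).trans ?_))
    rw [← ENNReal.ofReal_add (by positivity) (by positivity), add_halves]

theorem exists_bound_of_support {v : C(ℝ≥0, ℝ≥0)} {R : ℝ≥0} (hv : ∀ t, R < t → v t = 0) :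
    ∃ C, ∀ t, v t ≤ C := by
  obtain ⟨C, hC⟩ := (isCompact_Icc (a := (0 : ℝ≥0)) (b := R)).bddAbove_image
    v.continuous.continuousOn
  refine ⟨C, fun t => ?_⟩
  rcases le_or_gt t R with ht | ht
  · exact hC ⟨t, ⟨zero_le, ht⟩, rfl⟩
  · rw [hv t ht]
    exact zero_le

/-- A sequence whose restrictions to balls are uniformly approximable has a Gromov-vaguely
convergent subsequence. A fast decaying positive weight makes the whole spaces uniformly
approximable; the weight is divided out of the Gromov-weak limit. -/
theorem exists_subseq_gromovWeak_cutoff (X : ℕ → MMSpace)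
    (h : ∀ (R : ℕ) (ε : ℝ), 0 < ε → ∃ N, ∀ n, ((X n).restr R).IsApprox N ε) :
    ∃ (Z : MMSpace) (φ : ℕ → ℕ), StrictMono φ ∧
      ∀ k, GromovWeak (fun n => (X (φ n)).weight (cutoff k)) (Z.weight (cutoff k)) := by
  choose a ha using fun j : ℕ => h (j + 1) 1 one_pos
  obtain ⟨w, hw0, hw2, hw⟩ := exists_radial_weight a
  obtain ⟨Y, φ, hφ, -, hY⟩ := exists_subseq_gromovWeak (fun n => (X n).weight w) fun ε hε => by
    obtain ⟨N, hN⟩ := exists_isApprox_weight (S := range X) (a := a)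
      (by
        rintro _ ⟨n, rfl⟩ j
        have := (ha j n).1
        rwa [Nat.cast_add, Nat.cast_one] at this)
      (fun R ε hε => (h R ε hε).imp fun N hN => by rintro _ ⟨n, rfl⟩; exact hN n) hw2 hw hε
    exact ⟨N, fun n => hN _ ⟨n, rfl⟩⟩
  let v : C(ℝ≥0, ℝ≥0) := ⟨fun t => (w t)⁻¹, w.continuous.inv₀ fun t => (hw0 t).ne'⟩
  refine ⟨Y.weight v, φ, hφ, fun k => ?_⟩
  obtain ⟨C, hC⟩ := exists_bound_of_support (v := v * cutoff k) (R := k + 1) fun t ht => by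
    have : cutoff k t = 0 := cutoff_eq_zero (by exact_mod_cast ht.le)
    simp [this]
  have hwv : w * (v * cutoff k) = cutoff k := by
    ext t
    simp [v, (hw0 t).ne']
  have := hY.weight hC
  rw [weight_weight]
  simpa only [Function.comp_def, weight_weight, hwv] using this

end MMSpace

/-! ### Compactness criteria on representatives -/

namespace MMSpace

theorem exists_toFin_eq (𝒳 : MMFin) : ∃ (X : MMSpace) (h : X.mass < ∞), X.toFin h = 𝒳 := by
  obtain ⟨𝒳, h⟩ := 𝒳
  obtain ⟨X, rfl⟩ : ∃ X : MMSpace, X.toMM = 𝒳 := Quotient.exists_rep 𝒳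
  exact ⟨X, h, rfl⟩

theorem exists_toMM_eq (𝒳 : MM) : ∃ X : MMSpace, X.toMM = 𝒳 := Quotient.exists_rep 𝒳

theorem restr_toMM (R : ℝ) (X : MMSpace) :
    MM.restr R X.toMM = (X.restr R).toFin (X.mass_restr_lt_top R) := rfl

end MMSpace

open MMSpace

theorem relativelyCompact_restr_iff {K : Set MM} {R : ℝ} :
    RelativelyCompact (MM.restr R '' K) ↔ ∀ X : ℕ → MMSpace, (∀ n, (X n).toMM ∈ K) →
      ∃ (Z : MMSpace) (φ : ℕ → ℕ), StrictMono φ ∧ Z.mass < ∞ ∧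
        GromovWeak (fun n => (X (φ n)).restr R) Z := by
  rw [relativelyCompact_iff_forall_seq]
  constructor
  · intro h X hX
    obtain ⟨𝒵, φ, hφ, h𝒵⟩ := h (fun n => MM.restr R (X n).toMM) fun n => ⟨_, hX n, rfl⟩
    obtain ⟨Z, hZ, rfl⟩ := exists_toFin_eq 𝒵
    exact ⟨Z, φ, hφ, hZ, (tendsto_toFin_iff (fun n => (X (φ n)).mass_restr_lt_top R) hZ).1 h𝒵⟩
  · intro h u hu
    choose 𝒳 h𝒳 h𝒳u using hu
    choose X hX using fun n => exists_toMM_eq (𝒳 n)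
    obtain ⟨Z, φ, hφ, hZ, hlim⟩ := h X fun n => (hX n).symm ▸ h𝒳 n
    refine ⟨Z.toFin hZ, φ, hφ, ?_⟩
    have h1 : u ∘ φ = fun n => ((X (φ n)).restr R).toFin ((X (φ n)).mass_restr_lt_top R) := by
      funext n
      rw [← restr_toMM, hX, h𝒳u]
      rfl
    rw [h1]
    exact (tendsto_toFin_iff _ hZ).2 hlim

theorem relativelyCompact_iff_exists_gromovWeak {K : Set MM} :
    RelativelyCompact K ↔ ∀ X : ℕ → MMSpace, (∀ n, (X n).toMM ∈ K) →
      ∃ (Z : MMSpace) (φ : ℕ → ℕ), StrictMono φ ∧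
        ∀ k, GromovWeak (fun n => (X (φ n)).weight (cutoff k)) (Z.weight (cutoff k)) := by
  rw [relativelyCompact_iff_forall_seq]
  constructor
  · intro h X hX
    obtain ⟨𝒵, φ, hφ, h𝒵⟩ := h (fun n => (X n).toMM) hX
    obtain ⟨Z, rfl⟩ := exists_toMM_eq 𝒵
    exact ⟨Z, φ, hφ, MM.tendsto_mk_iff.1 h𝒵⟩
  · intro h u hu
    choose X hX using fun n => exists_toMM_eq (u n)
    obtain ⟨Z, φ, hφ, hlim⟩ := h X fun n => (hX n).symm ▸ hu n
    refine ⟨Z.toMM, φ, hφ, ?_⟩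
    have h1 : u ∘ φ = fun n => (X (φ n)).toMM := by
      funext n
      exact (hX _).symm
    rw [h1]
    exact MM.tendsto_mk_iff.2 hlim

/-- If every sequence in `K` has a subsequence whose transforms under `F` converge Gromov-weakly,
then the transforms of all members of `K` are uniformly approximable. -/
theorem exists_isApprox_of_subseq {K : Set MM} (F : MMSpace → MMSpace) (hF : ∀ X, (F X).mass < ∞)
    (h : ∀ X : ℕ → MMSpace, (∀ n, (X n).toMM ∈ K) → ∃ (Z : MMSpace) (φ : ℕ → ℕ), StrictMono φ ∧
      Z.mass < ∞ ∧ GromovWeak (fun n => F (X (φ n))) Z) {ε : ℝ} (hε : 0 < ε) :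
    ∃ N, ∀ X : MMSpace, X.toMM ∈ K → (F X).IsApprox N ε := by
  by_contra! hcon
  choose X hXK hX using hcon
  obtain ⟨Z, φ, hφ, hZ, hlim⟩ := h X hXK
  obtain ⟨N, hN⟩ := hlim.eventually_isApprox (fun n => hF _) hZ hε
  obtain ⟨n, hn, hNn⟩ := (hN.and (eventually_ge_atTop N)).exists
  exact hX (φ n) (hn.mono (hNn.trans (hφ.id_le n)) le_rfl)

/-- Cutting off beyond radius `R` is continuous, unlike the restriction to the ball of radius `R`
itself, so the approximation is obtained for the cut off spaces first. -/
theorem exists_isApprox_restr_of_relativelyCompact {K : Set MM} (hK : RelativelyCompact K) (R : ℝ)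
    {ε : ℝ} (hε : 0 < ε) : ∃ N, ∀ X : MMSpace, X.toMM ∈ K → (X.restr R).IsApprox N ε := by
  rw [relativelyCompact_iff_exists_gromovWeak] at hK
  obtain ⟨k, hk⟩ := exists_nat_ge R
  obtain ⟨N, hN⟩ := exists_isApprox_of_subseq (K := K) (fun X => X.weight (cutoff k))
    (fun X => X.mass_weight_cutoff_lt_top k) (fun X hX => by
      obtain ⟨Z, φ, hφ, hZ⟩ := hK X hX
      exact ⟨_, φ, hφ, Z.mass_weight_cutoff_lt_top k, hZ k⟩) hε
  exact ⟨N, fun X hX => (hN X hX).restr_of_weight_cutoff hk⟩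

theorem relativelyCompact_of_isApprox {K : Set MM}
    (h : ∀ (R : ℕ) (ε : ℝ), 0 < ε → ∃ N, ∀ X : MMSpace, X.toMM ∈ K → (X.restr R).IsApprox N ε) :
    RelativelyCompact K :=
  relativelyCompact_iff_exists_gromovWeak.2 fun X hX => exists_subseq_gromovWeak_cutoff X
    fun R ε hε => (h R ε hε).imp fun _ hN n => hN _ (hX n)

theorem relativelyCompact_tfae (K : Set MM) : List.TFAE [
    RelativelyCompact K,
    ∀ R : ℝ, 0 < R → RelativelyCompact (MM.restr R '' K),
    ∃ R : ℕ → ℝ, (∀ k, 0 < R k) ∧ Tendsto R atTop atTop ∧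
      ∀ k, RelativelyCompact (MM.restr (R k) '' K)] := by
  tfae_have 1 → 2 := by
    intro hK R _
    refine relativelyCompact_restr_iff.2 fun X hX => ?_
    obtain ⟨Z, φ, hφ, hZ, hlim⟩ := exists_subseq_gromovWeak (fun n => (X n).restr R) fun ε hε =>
      (exists_isApprox_restr_of_relativelyCompact hK R hε).imp fun N hN n => hN _ (hX n)
    exact ⟨Z, φ, hφ, hZ, hlim⟩
  tfae_have 2 → 3 := fun h => ⟨fun k => k + 1, fun k => by positivity,
    tendsto_atTop_add_const_right _ _ tendsto_natCast_atTop_atTop, fun k => h _ (by positivity)⟩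
  tfae_have 3 → 1 := by
    rintro ⟨R, -, hR, h⟩
    refine relativelyCompact_of_isApprox fun k ε hε => ?_
    obtain ⟨l, hl⟩ := (hR.eventually_ge_atTop (k : ℝ)).exists
    obtain ⟨N, hN⟩ := exists_isApprox_of_subseq (fun X => X.restr (R l))
      (fun X => X.mass_restr_lt_top _) (relativelyCompact_restr_iff.1 (h l)) hε
    refine ⟨N, fun X hX => ?_⟩
    have h1 := (hN X hX).restr k
    have h2 : (X.restr (R l)).restr k = X.restr k := by
      refine ext_measure (X := X) ?_
      change (X.μ.restrict (Metric.closedBall X.root (R l))).restrict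
        (Metric.closedBall X.root (k : ℝ)) = _
      rw [Measure.restrict_restrict Metric.isClosed_closedBall.measurableSet,
        inter_eq_left.2 (Metric.closedBall_subset_closedBall hl)]
    rwa [h2] at h1
  tfae_finish

/-! ### Separated sets and Heine–Borel limits -/

/-- A set without `m` points at pairwise distance greater than `δ` has packing number less
than `m`. -/
theorem packingNumber_lt_of_forall_fin {α : Type*} [PseudoMetricSpace α] {A : Set α} {δ : ℝ≥0}
    {m : ℕ}
    (h : ∀ p : Fin m → α, (∀ i, p i ∈ A) → ¬ Pairwise fun i j => (δ : ℝ) < dist (p i) (p j)) :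
    Metric.packingNumber δ A < m := by
  by_contra! hcon
  have hm : (m : ℕ∞) ≠ 0 := by
    rintro h0
    have h0' : m = 0 := by exact_mod_cast h0
    subst h0'
    exact h Fin.elim0 (fun i => i.elim0) fun i => i.elim0
  obtain ⟨C, hCA, hC, hCm⟩ : ∃ C ⊆ A, Metric.IsSeparated δ C ∧ (m : ℕ∞) ≤ C.encard := by
    by_contra! hlt
    obtain ⟨l, rfl⟩ := Nat.exists_eq_succ_of_ne_zero (n := m) (by exact_mod_cast hm)
    have : Metric.packingNumber δ A ≤ l := by
      refine iSup_le fun C => iSup_le fun hCA => iSup_le fun hC => ?_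
      have := hlt C hCA hC
      rw [Nat.succ_eq_add_one, Nat.cast_add, Nat.cast_one] at this
      exact ENat.lt_add_one_iff (ENat.natCast_ne_top l) |>.1 this
    have h2 := hcon.trans this
    have h3 : l + 1 ≤ l := by exact_mod_cast h2
    omega
  obtain ⟨T, hTC, hT⟩ := exists_subset_encard_eq hCm
  have hTf : T.Finite := finite_of_encard_eq_coe hT
  have hcard : hTf.toFinset.card = m := by
    rw [hTf.encard_eq_coe_toFinset_card] at hT
    exact_mod_cast hT
  let e := (hTf.toFinset.equivFinOfCardEq hcard).symm
  have he : ∀ i, (e i : α) ∈ T := fun i => hTf.mem_toFinset.1 (e i).2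
  refine h (fun i => e i) (fun i => hCA (hTC (he i))) fun i j hij => ?_
  have hne : (e i : α) ≠ e j := fun h => hij (e.injective (Subtype.ext h))
  have hlt : (δ : ℝ≥0∞) < edist (e i : α) (e j) := hC (hTC (he i)) (hTC (he j)) hne
  rw [edist_nndist] at hlt
  exact ENNReal.coe_lt_coe.1 hlt

namespace MMSpace

/-- Balls around separated points are disjoint, so their masses add up to at most the mass of a
larger ball. -/
theorem card_mul_lowerMass_le (X : MMSpace) {R δ : ℝ} {m : ℕ} {p : Fin m → X.carrier}
    (hp : ∀ i, p i ∈ Metric.ball X.root R ∩ X.μ.support)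
    (hsep : Pairwise fun i j => δ < dist (p i) (p j)) (hδ : 0 < δ) :
    m * X.lowerMass (δ / 2) R ≤ X.ballMass (R + δ) := by
  have hdisj : Pairwise (Function.onFun Disjoint fun i => Metric.closedBall (p i) (δ / 2)) :=
    fun i j hij => Metric.closedBall_disjoint_closedBall (by linarith [hsep hij])
  calc m * X.lowerMass (δ / 2) R = ∑ _i : Fin m, X.lowerMass (δ / 2) R := by simp
    _ ≤ ∑ i, X.μ (Metric.closedBall (p i) (δ / 2)) :=
        Finset.sum_le_sum fun i _ => iInf₂_le (p i) (hp i)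
    _ = X.μ (⋃ i, Metric.closedBall (p i) (δ / 2)) := by
        rw [measure_iUnion hdisj fun i => Metric.isClosed_closedBall.measurableSet, tsum_fintype]
    _ ≤ X.ballMass (R + δ) := by
        refine measure_mono (iUnion_subset fun i x hx => ?_)
        have h1 := (hp i).1
        rw [Metric.mem_ball] at h1 ⊢
        rw [Metric.mem_closedBall] at hx
        linarith [dist_triangle x (p i) X.root]

/-- A bound for the packing number of the support within a ball makes the restriction to a smaller
ball approximable, as a maximal separated set is a cover. -/
theorem isApprox_restr_of_packingNumber_lt {X : MMSpace} {R : ℕ} {ε : ℝ≥0} {m M : ℕ}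
    (hm : Metric.packingNumber ε (Metric.ball X.root (R + 1) ∩ X.μ.support) < m)
    (hM : X.ballMass (R + 1) ≤ M) : (X.restr R).IsApprox (max (max m M) (R + 1)) ε := by
  set A := Metric.ball X.root (R + 1 : ℝ) ∩ X.μ.support with hA
  set C := Metric.maximalSeparatedSet ε A
  have hCcard : C.encard < m := (Metric.encard_maximalSeparatedSet hm.ne_top).trans_lt hm
  have hCfin : C.Finite := finite_of_encard_le_coe hCcard.le
  set l := hCfin.toFinset.toList
  have hl : ∀ x, x ∈ l ↔ x ∈ C := fun x => by simp [l]
  have hlm : l.length < m := by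
    rw [hCfin.encard_eq_coe_toFinset_card] at hCcard
    simpa [l] using hCcard
  refine ⟨?_, fun i => l.getD i X.root, fun i => ?_, ?_⟩
  · have h1 : (X.restr R).mass ≤ X.ballMass (R + 1) := by
      change X.μ.restrict (Metric.closedBall X.root R) univ ≤ _
      rw [Measure.restrict_apply_univ]
      exact measure_mono (Metric.closedBall_subset_ball (by linarith))
    refine (h1.trans hM).trans ?_
    exact_mod_cast (le_max_right m M).trans (le_max_left _ _)
  · have h1 : dist X.root (l.getD i X.root) ≤ R + 1 := by
      rcases lt_or_ge i l.length with hi | hi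
      · rw [List.getD_eq_getElem _ _ hi]
        have h2 := (Metric.maximalSeparatedSet_subset ((hl _).1 (List.getElem_mem hi))).1
        rw [Metric.mem_ball, dist_comm] at h2
        exact h2.le
      · rw [List.getD_eq_default _ _ hi, dist_self]
        positivity
    refine h1.trans ?_
    exact_mod_cast le_max_right (max m M) (R + 1)
  · have h0 : (X.restr R).μ {x | ∀ i < max (max m M) (R + 1), (ε : ℝ) < dist x (l.getD i X.root)}
        = 0 := by
      refine measure_eq_zero_iff_ae_notMem.2 ?_
      change ∀ᵐ x ∂(X.μ.restrict (Metric.closedBall X.root R)),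
        ¬ ∀ i < max (max m M) (R + 1), (ε : ℝ) < dist x (l.getD i X.root)
      rw [ae_restrict_iff' Metric.isClosed_closedBall.measurableSet]
      filter_upwards [Measure.support_mem_ae (μ := X.μ)] with x hx hxR hfar
      have hxA : x ∈ A := ⟨Metric.closedBall_subset_ball (by linarith) hxR, hx⟩
      obtain ⟨y, hyC, hxy⟩ := Metric.isCover_maximalSeparatedSet hm.ne_top hxA
      obtain ⟨i, hi, rfl⟩ := List.getElem_of_mem ((hl y).2 hyC)
      have h1 := hfar i ((hi.trans hlm).trans_le ((le_max_left _ _).trans (le_max_left _ _)))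
      rw [List.getD_eq_getElem _ _ hi] at h1
      have h2 : edist x l[i] ≤ ε := hxy
      rw [edist_nndist] at h2
      have h3 : nndist x l[i] ≤ ε := by exact_mod_cast h2
      exact absurd h1 (not_lt.2 h3)
    exact h0.le.trans zero_le

/-- A continuous function of the distance matrix of `m` sampled points which is positive exactly
if the points are at pairwise distance greater than `δ`. -/
noncomputable def separation (m : ℕ) (δ : ℝ≥0) (d : Fin (m + 1) → Fin (m + 1) → ℝ≥0) : ℝ≥0 :=
  ∏ i : Fin m, ∏ j : Fin m, if i = j then 1 else min 1 (d i.succ j.succ - δ)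

theorem continuous_separation (m : ℕ) (δ : ℝ≥0) : Continuous (separation m δ) := by
  refine continuous_finsetProd _ fun i _ => continuous_finsetProd _ fun j _ => ?_
  split_ifs
  · exact continuous_const
  · exact continuous_const.min ((continuous_apply_apply _ _).sub continuous_const)

theorem separation_le_one (m : ℕ) (δ : ℝ≥0) (d : Fin (m + 1) → Fin (m + 1) → ℝ≥0) :
    separation m δ d ≤ 1 := by
  refine Finset.prod_le_one' fun i _ => Finset.prod_le_one' fun j _ => ?_
  split_ifs
  · exact le_rfl
  · exact min_le_left _ _

theorem separation_distMatrix_ne_zero {X : MMSpace} {m : ℕ} {δ : ℝ≥0} {x : Fin m → X.carrier} :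
    separation m δ (X.distMatrix m x) ≠ 0 ↔ Pairwise fun i j => (δ : ℝ) < dist (x i) (x j) := by
  simp only [separation, Finset.prod_ne_zero_iff, Finset.mem_univ, true_implies]
  refine forall_congr' fun i => forall_congr' fun j => ?_
  by_cases hij : i = j
  · simp [hij]
  · have h1 : (δ : ℝ) < dist (x i) (x j) ↔ δ < nndist (x i) (x j) := Iff.rfl
    simp only [hij, if_false, distMatrix, Fin.cons_succ, ne_eq, not_false_eq_true, true_implies, h1]
    rw [← ne_eq, ← pos_iff_ne_zero, lt_min_iff, tsub_pos_iff_lt]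
    simp

/-- The absence of `m` separated points of the support in balls passes to limits, since it is the
vanishing of the integral of a continuous function of the distance matrix. -/
theorem not_pairwise_lt_dist_of_gromovWeak {X : ℕ → MMSpace} {Z : MMSpace} {k m : ℕ} {δ : ℝ≥0}
    (h : GromovWeak (fun n => (X n).weight (cutoff k)) (Z.weight (cutoff k)))
    (hX : ∀ n, ∀ p : Fin m → (X n).carrier,
      (∀ i, p i ∈ Metric.ball (X n).root (k + 1) ∩ (X n).μ.support) →
        ¬ Pairwise fun i j => (δ : ℝ) < dist (p i) (p j))
    {p : Fin m → Z.carrier} (hp : ∀ i, p i ∈ Metric.closedBall Z.root k ∩ Z.μ.support) :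
    ¬ Pairwise fun i j => (δ : ℝ) < dist (p i) (p j) := by
  have hcont : ∀ Y : MMSpace, Continuous fun x : Fin m → Y.carrier =>
      (∏ i, cutoff k (nndist Y.root (x i))) * separation m δ (Y.distMatrix m x) := fun Y =>
    (continuous_finsetProd _ fun i _ =>
      (cutoff k).continuous.comp (continuous_const.nndist (continuous_apply i))).mul
      ((continuous_separation m δ).comp (Y.continuous_distMatrix m))
  have hmeas : ∀ Y : MMSpace, Measurable fun x : Fin m → Y.carrier =>
      (separation m δ (Y.distMatrix m x) : ℝ≥0∞) := fun Y =>
    ((continuous_separation m δ).comp (Y.continuous_distMatrix m)).measurable.coe_nnreal_ennreal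
  have hint : ∀ Y : MMSpace, ∫⁻ x, (separation m δ (Y.distMatrix m x) : ℝ≥0∞)
      ∂(Measure.pi fun _ : Fin m => (Y.weight (cutoff k)).μ) =
      ∫⁻ x, ((∏ i, cutoff k (nndist Y.root (x i))) * separation m δ (Y.distMatrix m x) : ℝ≥0)
        ∂(Measure.pi fun _ : Fin m => Y.μ) := fun Y => by
    refine (Y.lintegral_pi_weight (cutoff k) m (hmeas Y)).trans (lintegral_congr fun x => ?_)
    rw [ENNReal.coe_mul, ENNReal.ofNNReal_finsetProd]
  have hzero : ∀ n, ∫⁻ x, (separation m δ ((X n).distMatrix m x) : ℝ≥0∞)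
      ∂(Measure.pi fun _ : Fin m => ((X n).weight (cutoff k)).μ) = 0 := by
    intro n
    rw [hint]
    refine lintegral_eq_zero_of_ae_eq_zero ?_
    have h1 : ∀ᵐ x ∂(Measure.pi fun _ : Fin m => (X n).μ), ∀ i, x i ∈ (X n).μ.support :=
      eventually_all.2 fun i => Measure.tendsto_eval_ae_ae.eventually Measure.support_mem_ae
    filter_upwards [h1] with x hx
    change (((∏ i, cutoff k (nndist (X n).root (x i))) *
      separation m δ ((X n).distMatrix m x) : ℝ≥0) : ℝ≥0∞) = 0
    by_contra hne
    rw [ENNReal.coe_eq_zero, mul_eq_zero, not_or, Finset.prod_eq_zero_iff] at hne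
    refine hX n x (fun i => ⟨?_, hx i⟩) (separation_distMatrix_ne_zero.1 hne.2)
    rw [Metric.mem_ball, dist_comm]
    by_contra! hfar
    exact hne.1 ⟨i, Finset.mem_univ i, cutoff_eq_zero hfar⟩
  have hlim := h.tendsto_lintegral m (continuous_separation m δ) (separation_le_one m δ)
  have hZ : ∫⁻ x, (separation m δ (Z.distMatrix m x) : ℝ≥0∞)
      ∂(Measure.pi fun _ : Fin m => (Z.weight (cutoff k)).μ) = 0 :=
    tendsto_nhds_unique hlim (tendsto_const_nhds.congr fun n => (hzero n).symm)
  rw [hint, lintegral_eq_zero_iff (hcont Z).measurable.coe_nnreal_ennreal] at hZ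
  intro hsep
  -- the integrand is positive near `p`, and neighbourhoods of points of the support are charged
  have hpos : (∏ i, cutoff k (nndist Z.root (p i))) * separation m δ (Z.distMatrix m p) ≠ 0 := by
    refine mul_ne_zero (Finset.prod_ne_zero_iff.2 fun i _ => ?_)
      (separation_distMatrix_ne_zero.2 hsep)
    have h1 := (hp i).1
    rw [Metric.mem_closedBall, dist_comm] at h1
    rw [cutoff_eq_one (t := nndist Z.root (p i)) h1]
    exact one_ne_zero
  have hopen := (isOpen_ne.preimage (hcont Z)).mem_nhds hpos
  rw [nhds_pi, Filter.mem_pi'] at hopen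
  obtain ⟨I, t, ht, hsub⟩ := hopen
  have hnull : Measure.pi (fun _ : Fin m => Z.μ) (univ.pi t) = 0 := by
    refine measure_mono_null (fun x hx => ?_) hZ
    have := hsub (fun i _ => hx i (mem_univ i))
    exact ENNReal.coe_ne_zero.2 this
  rw [Measure.pi_pi, Finset.prod_eq_zero_iff] at hnull
  obtain ⟨i, -, hi⟩ := hnull
  exact ((Measure.mem_support_iff_forall (p i)).1 (hp i).2 (t i) (ht i)).ne' hi

/-- If all balls of the support have finite packing numbers, the space is equivalent to a
Heine–Borel space. -/
theorem toMM_mem_XHB {Z : MMSpace} (h : ∀ (k : ℕ) (δ : ℝ≥0), 0 < δ →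
      Metric.packingNumber δ (Metric.closedBall Z.root k ∩ Z.μ.support) < ⊤) :
    Z.toMM ∈ MM.XHB := by
  refine ⟨Z.coreSpace, Quotient.sound Z.isEmb_coreSpace.equivalent, ?_⟩
  have hcpt : ∀ k : ℕ, IsCompact (Metric.closedBall Z.root (k : ℝ) ∩ Z.μ.support) := by
    intro k
    refine isCompact_iff_totallyBounded_isComplete.2 ⟨?_,
      (Metric.isClosed_closedBall.inter Measure.isClosed_support).isComplete⟩
    rw [Metric.totallyBounded_iff]
    intro ε hε
    have hδ : 0 < (ε / 2).toNNReal := Real.toNNReal_pos.2 (by positivity)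
    have hfin := h k _ hδ
    have hC := Metric.isCover_maximalSeparatedSet hfin.ne
    refine ⟨_, ?_, (Metric.isCover_iff_subset_iUnion_closedBall.1 hC).trans
      (iUnion₂_mono fun y _ => Metric.closedBall_subset_ball ?_)⟩
    · rw [← encard_lt_top_iff, Metric.encard_maximalSeparatedSet hfin.ne]
      exact hfin
    · rw [Real.coe_toNNReal _ (by positivity)]
      linarith
  have hcore : ∀ k : ℕ, IsCompact (Metric.closedBall Z.root (k : ℝ) ∩ Z.core) := by
    intro k
    refine ((hcpt k).union (isCompact_singleton (x := Z.root))).of_isClosed_subset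
      (Metric.isClosed_closedBall.inter Z.isClosed_core) ?_
    rintro x ⟨hx, hxs | hxr⟩
    · exact Or.inl ⟨hx, hxs⟩
    · exact Or.inr hxr
  have hemb : IsClosedEmbedding (Subtype.val : Z.core → Z.carrier) :=
    Z.isClosed_core.isClosedEmbedding_subtypeVal
  change ProperSpace Z.core
  refine ⟨fun x r => ?_⟩
  obtain ⟨k, hk⟩ := exists_nat_ge (r + dist (x : Z.carrier) Z.root)
  refine (hemb.isCompact_preimage (hcore k)).of_isClosed_subset Metric.isClosed_closedBall ?_
  intro y hy
  refine ⟨?_, y.2⟩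
  rw [Metric.mem_closedBall] at hy ⊢
  have hy' : dist (y : Z.carrier) x ≤ r := hy
  linarith [dist_triangle (y : Z.carrier) x Z.root]

end MMSpace

open MMSpace

theorem iSup_ballMass_lt_top_of_relativelyCompact {K : Set MM}
    (hK : RelativelyCompact K) (R : ℝ) : ⨆ 𝒳 ∈ K, MM.ballMass R 𝒳 < ∞ := by
  obtain ⟨N, hN⟩ := exists_isApprox_restr_of_relativelyCompact hK R one_pos
  refine (iSup₂_le fun 𝒳 h𝒳 => ?_ : _ ≤ (N : ℝ≥0∞)).trans_lt (ENNReal.natCast_lt_top N)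
  obtain ⟨X, rfl⟩ := exists_toMM_eq 𝒳
  refine le_trans ?_ (hN X h𝒳).1
  change X.μ (Metric.ball X.root R) ≤ X.μ.restrict (Metric.closedBall X.root R) univ
  rw [Measure.restrict_apply_univ]
  exact measure_mono Metric.ball_subset_closedBall

/-- Lower mass bounds and upper mass bounds together limit the number of separated points of the
supports within a ball, uniformly over the family. -/
theorem exists_forall_not_pairwise_lt_dist {K : Set MM} (hK : MM.LocalLowerMassBound K)
    (hM : ∀ R : ℝ, 0 < R → ⨆ 𝒳 ∈ K, MM.ballMass R 𝒳 < ∞) (R : ℝ) {δ : ℝ} (hδ : 0 < δ) :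
    ∃ m : ℕ, ∀ X : MMSpace, X.toMM ∈ K → ∀ p : Fin m → X.carrier,
      (∀ i, p i ∈ Metric.ball X.root R ∩ X.μ.support) →
        ¬ Pairwise fun i j => δ < dist (p i) (p j) := by
  -- the lower mass bound at scale `δ / 2` is available only for radii above `δ / 2`
  set R' := max R δ
  have hR' : 0 < R' := lt_max_of_lt_right hδ
  have hc := hK R' (δ / 2) (by positivity) (lt_max_of_lt_right (by linarith))
  have hM' := hM (R' + δ) (by positivity)
  set c := ⨅ 𝒳 ∈ K, MM.lowerMass (δ / 2) R' 𝒳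
  set M := ⨆ 𝒳 ∈ K, MM.ballMass (R' + δ) 𝒳
  obtain ⟨m, hm⟩ := ENNReal.exists_nat_mul_gt hc.ne' hM'.ne
  refine ⟨m, fun X hX p hp hsep => hm.not_ge ?_⟩
  calc m * c ≤ m * X.lowerMass (δ / 2) R' := by
        gcongr
        exact iInf₂_le X.toMM hX
    _ ≤ X.ballMass (R' + δ) := X.card_mul_lowerMass_le
        (fun i => ⟨Metric.ball_subset_ball (le_max_left _ _) (hp i).1, (hp i).2⟩) hsep hδ
    _ ≤ M := le_iSup₂ (f := fun 𝒳 (_ : 𝒳 ∈ K) => MM.ballMass (R' + δ) 𝒳) X.toMM hX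

/-- The mass bounds limit the number of separated points in the supports. This gives the uniform
approximation needed for a subsequential limit in the space of all classes, and it passes to that
limit, which is therefore a Heine–Borel space. -/
theorem relativelyCompact_preimage_XHB {K : Set MM} (hK : MM.LocalLowerMassBound K)
    (hM : ∀ R : ℝ, 0 < R → ⨆ 𝒳 ∈ K, MM.ballMass R 𝒳 < ∞) :
    RelativelyCompact (Subtype.val ⁻¹' K : Set MM.XHB) := by
  have hsep := exists_forall_not_pairwise_lt_dist hK hM
  have hKc : RelativelyCompact K := by
    refine relativelyCompact_of_isApprox fun R ε hε => ?_
    obtain ⟨m, hm⟩ := hsep (R + 1) hε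
    obtain ⟨M, hM'⟩ := ENNReal.exists_nat_gt (hM (R + 1) (by positivity)).ne
    refine ⟨max (max m M) (R + 1), fun X hX => ?_⟩
    have h1 := isApprox_restr_of_packingNumber_lt (X := X) (R := R) (ε := ⟨ε, hε.le⟩)
      (packingNumber_lt_of_forall_fin (hm X hX))
      ((le_iSup₂ (f := fun 𝒳 (_ : 𝒳 ∈ K) => MM.ballMass (R + 1) 𝒳) X.toMM hX).trans hM'.le)
    exact h1
  have : TopologicalSpace.PseudoMetrizableSpace MM.XHB :=
    IsInducing.subtypeVal.pseudoMetrizableSpace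
  rw [relativelyCompact_iff_forall_seq]
  intro u hu
  choose X hX using fun n => exists_toMM_eq (u n)
  have hXK : ∀ n, (X n).toMM ∈ K := fun n => (hX n).symm ▸ hu n
  obtain ⟨Z, φ, hφ, hlim⟩ := relativelyCompact_iff_exists_gromovWeak.1 hKc X hXK
  have hZ : Z.toMM ∈ MM.XHB := toMM_mem_XHB fun k δ hδ => by
    obtain ⟨m, hm⟩ := hsep (k + 1) (NNReal.coe_pos.2 hδ)
    exact (packingNumber_lt_of_forall_fin fun p hp =>
      not_pairwise_lt_dist_of_gromovWeak (hlim k) (fun n => hm _ (hXK _)) hp).trans_le le_top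
  refine ⟨⟨Z.toMM, hZ⟩, φ, hφ, tendsto_subtype_rng.2 ?_⟩
  have h1 : (fun n => ((u ∘ φ) n : MM)) = fun n => (X (φ n)).toMM := by
    funext n
    exact (hX _).symm
  rw [h1]
  exact MM.tendsto_mk_iff.2 hlim

theorem relativelyCompact_of_preimage_XHB {K : Set MM} (hK : K ⊆ MM.XHB)
    (h : RelativelyCompact (Subtype.val ⁻¹' K : Set MM.XHB)) : RelativelyCompact K := by
  have hc : IsCompact (Subtype.val '' closure (Subtype.val ⁻¹' K : Set MM.XHB)) :=
    IsCompact.image h continuous_subtype_val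
  refine hc.closure_of_subset fun 𝒳 h𝒳 => ?_
  exact ⟨⟨𝒳, hK h𝒳⟩, subset_closure h𝒳, rfl⟩

end GromovVague

open GromovVague in
theorem mainTheorem4 :
    (∀ K : Set MM, List.TFAE [
      RelativelyCompact K,
      ∀ R : ℝ, 0 < R → RelativelyCompact (MM.restr R '' K),
      ∃ R : ℕ → ℝ, (∀ k, 0 < R k) ∧ Tendsto R atTop atTop ∧
        ∀ k, RelativelyCompact (MM.restr (R k) '' K)]) ∧
    (∀ K : Set MM, K ⊆ MM.XHB → MM.LocalLowerMassBound K →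
      (RelativelyCompact (Subtype.val ⁻¹' K : Set MM.XHB) ↔
        ∀ R : ℝ, 0 < R → (⨆ 𝒳 ∈ K, MM.ballMass R 𝒳) < ∞)) :=
  ⟨relativelyCompact_tfae, fun _ hK hlow =>
    ⟨fun h R _ => iSup_ballMass_lt_top_of_relativelyCompact
      (relativelyCompact_of_preimage_XHB hK h) R,
    relativelyCompact_preimage_XHB hlow⟩⟩
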